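/- **Setting.** A pairwise Markov random field (MRF) consists of a simple graph $G=(V,E)$ with $V=\{1,\dots,n\}$, $n\ge 1$, a finite non-empty alphabet $\Sigma$, and potentials $\phi_v:\Sigma\to\mathbb R_{\ge 0}$ $(v\in V)$ and $\psi_{uv}:\Sigma^2\to\mathbb R_{\ge 0}$ $(\{u,v\}\in E,\ u<v)$. Put $\mathcal H(x)=\sum_{v\in V}\phi_v(x_v)+\sum_{\{u,v\}\in E}\psi_{uv}(x_u,x_v)$ for $x\in\Sigma^n$; a MAP assignment $x^*$ is a maximizer of $\mathcal H$. Let $d_G$ be the shortest-path metric ($\infty$ between different components) and $\mathbf B(v,r)=\{u: d_G(u,v)<r\}$. The doubling dimension of $G$ is $\log_2\lambda$, where $\lambda$ is the least integer such that every ball $\mathbf B(v,r)$ is contained in a union of at most $\lambda$ balls of radius $r/2$. **Db-dim$(\varphi,K)$**, for $\varphi\in(0,1)$ and an integer $K\ge 1$, on a finite graph with metric $d$: let $\mathbf Q$ be the random variable with $\Pr[\mathbf Q=i]=\varphi(1-\varphi)^{i-1}$ for $1\le i<K$ and $\Pr[\mathbf Q=K]=(1-\varphi)^{K-1}$. Initially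 all vertices are white. While there are white vertices, choose a white vertex $u$ uniformly at random and draw an independent copy $Q$ of $\mathbf Q$; the white vertices $w$ with $d(u,w)=Q$ become blue, those with $d(u,w)<Q$ become red. The output is the set of blue vertices. **Mode** using Db-dim$(\varphi,K)$: run Db-dim$(\varphi,K)$ on the graph whose vertices are the edges of $G$, two of them adjacent when they share an endpoint, to obtain a random set $\mathcal B\subset E$. On each connected component of $(V,E\setminus\mathcal B)$ compute by exhaustive search an exact MAP assignment for the potentials of its vertices and of its edges in $E\setminus\mathcal B$ (ties broken in any way). These together form the output $\widehat{x}$. **Theorem.** For real $\rho\ge 1$ and $\varepsilon\in(0,1)$ put $\varphi=\varepsilon 2^{-\rho-3}$ and $K(\varphi,\rho)=\frac{12\rho}{\varphi}\log\frac{24\rho}{\varphi}$ (natural logarithm). Let an MRF be given whose graph $G$ on $n$ vertices has doubling dimension at most $\rho$. Then Mode using Db-dim$(\varphi,\lceil K(\varphi,\rho)\rceil)$ outputs $\widehat x$ with $$\mathbb E\left[\mathcal H(x^*)-\mathcal H(\widehat x)\right]\le\varepsilon\,\mathcal H(x^*).$$ If $|\Sigma|\ge 2$, the algorithm, implemented on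 a random-access machine with unit-cost real arithmetic and random draws (uniform draws at one step, draws of $\mathbf Q$ at $\lceil K(\varphi,\rho)\rceil$ steps), with $G$ given by adjacency lists and with $\varphi$ and $\lceil K(\varphi,\rho)\rceil$ given, always finishes within $$O\left(n\,2^{\rho}\,|\Sigma|^{K(\varphi,\rho)^{2\rho}}\right)$$ steps, with an absolute constant. Further, for a fixed finite non-empty alphabet $\Sigma$ and a sequence of instances with $n\to\infty$ whose parameters $\rho\ge1$ and $\varepsilon\in(0,1)$ (which may vary) satisfy $\rho(\rho+\log(1/\varepsilon))=o(\log\log n)$, the algorithm takes $o(n^{1+\delta})$ steps, for every $\delta>0$. -/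

import Mathlib

open Filter Asymptotics
open scoped ENNReal NNReal

noncomputable section

namespace ModeAlg

/-! ### Doubling dimension -/

/-- The open ball `{w | d(v, w) < r}` of the shortest-path metric (`d = ∞` between components). -/
def ball {V : Type*} (G : SimpleGraph V) (v : V) (r : ℝ≥0) : Set V :=
  {w | ((G.edist v w : ℕ∞) : ℝ≥0∞) < (r : ℝ≥0∞)}

/-- The least `k` such that every ball is covered by at most `k` balls of half its radius. -/
def doublingConstant {V : Type*} (G : SimpleGraph V) : ℕ :=
  sInf {k | ∀ (v : V) (r : ℝ≥0), ∃ s : Finset V, s.card ≤ k ∧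
    ball G v r ⊆ ⋃ u ∈ s, ball G u (r / 2)}

/-- The doubling dimension: the binary logarithm of the doubling constant. -/
def doublingDim {V : Type*} (G : SimpleGraph V) : ℝ :=
  Real.logb 2 (doublingConstant G)

/-! ### The randomized decomposition -/

/-- The point masses of the law of `Q` on `{1, …, K}`. -/
def stopMass (p : ℝ) (K i : ℕ) : ℝ :=
  if 1 ≤ i ∧ i < K then p * (1 - p) ^ (i - 1) else if i = K then (1 - p) ^ (K - 1) else 0

lemma stopMass_nonneg {p : ℝ} (hp : p ∈ Set.Icc (0 : ℝ) 1) (K i : ℕ) : 0 ≤ stopMass p K i := by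
  have h1 : 0 ≤ 1 - p := sub_nonneg.2 hp.2
  have h0 : 0 ≤ p := hp.1
  unfold stopMass
  split_ifs <;> positivity

lemma sum_stopMass (p : ℝ) (K : ℕ) : ∑ i ∈ Finset.range (K + 1), stopMass p K i = 1 := by
  have key : ∀ m k : ℕ, m ≤ k → ∑ i ∈ Finset.range (m + 1), stopMass p (k + 1) i
      = 1 - (1 - p) ^ m := by
    intro m
    induction m with
    | zero => intro k _; simp [stopMass]
    | succ m ih =>
      intro k hk
      rw [Finset.sum_range_succ, ih k (by omega)]
      have : stopMass p (k + 1) (m + 1) = p * (1 - p) ^ m := by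
        simp [stopMass]; intro h; omega
      rw [this]; ring
  cases K with
  | zero => simp [stopMass]
  | succ k =>
    rw [Finset.sum_range_succ, key k k le_rfl]
    simp [stopMass]

/-- The law of `Q`: `P(Q = i) = p (1 - p) ^ (i - 1)` for `1 ≤ i < K` and
`P(Q = K) = (1 - p) ^ (K - 1)`. -/
def stopLaw (p : ℝ) (hp : p ∈ Set.Icc (0 : ℝ) 1) (K : ℕ) : PMF ℕ :=
  PMF.ofFinset (fun i => ENNReal.ofReal (stopMass p K i)) (Finset.range (K + 1))
    (by
      rw [← ENNReal.ofReal_sum_of_nonneg fun i _ => stopMass_nonneg hp K i, sum_stopMass]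
      simp)
    (by
      intro i hi
      have hi' : K + 1 ≤ i := by simpa using hi
      have h1 : ¬ (1 ≤ i ∧ i < K) := by omega
      have h2 : i ≠ K := by omega
      simp [stopMass, h1, h2])

open Classical in
/-- The loop of the node decomposition, from a state with white set `W` and blue set `B` (all
other vertices are red): while `W` is nonempty, draw `u` uniformly from `W` and `q` from `Q`;
the white vertices at distance `q` from `u` turn blue, those at distance `< q` turn red, those
at distance `> q` stay white. The output is the final blue set. -/
def dbDimFrom {V : Type} (H : SimpleGraph V) (Q : PMF ℕ) (W B : Finset V) : PMF (Finset V) :=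
  if h : W.Nonempty then
    haveI : Nonempty ↥W := h.to_subtype
    (PMF.uniformOfFintype ↥W).bind fun u =>
      Q.bind fun q =>
        dbDimFrom H Q (W.filter fun w => (q : ℕ∞) < H.edist u w)
          (B ∪ W.filter fun w => H.edist u w = (q : ℕ∞))
  else PMF.pure B
termination_by W.card
decreasing_by
  apply Finset.card_lt_card
  refine Finset.ssubset_iff_subset_ne.2 ⟨Finset.filter_subset _ _, fun he => ?_⟩
  have hu := (Finset.ext_iff.1 he u).2 u.2
  simp at hu

/-- `Db-dim(p, K)` on the graph `H`: the law of the random set of removed vertices. -/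
def dbDim {V : Type} [Fintype V] (H : SimpleGraph V) (p : ℝ) (hp : p ∈ Set.Icc (0 : ℝ) 1)
    (K : ℕ) : PMF (Finset V) :=
  dbDimFrom H (stopLaw p hp K) Finset.univ ∅

/-! ### Pairwise Markov random fields -/

/-- A pairwise Markov random field on `n` vertices over the alphabet `S`, in exponential form.
`edgePot e a b` is the potential of the edge `e` when its smaller endpoint has value `a` and its
larger endpoint has value `b`. -/
structure MRF (n : ℕ) (S : Type) where
  graph : SimpleGraph (Fin n)
  nodePot : Fin n → S → ℝ
  edgePot : graph.edgeSet → S → S → ℝ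
  nodePot_nonneg : ∀ v a, 0 ≤ nodePot v a
  edgePot_nonneg : ∀ e a b, 0 ≤ edgePot e a b

namespace MRF

variable {n : ℕ} {S : Type} (M : MRF n S)

/-- The set of edges. -/
abbrev Edge : Type := M.graph.edgeSet

/-- The smaller endpoint of an edge. -/
def lo (e : M.Edge) : Fin n := e.1.inf

/-- The larger endpoint of an edge. -/
def hi (e : M.Edge) : Fin n := e.1.sup

instance : Fintype M.Edge := Fintype.ofFinite _

/-- The function `H(x)`, the sum of all node and edge potentials. -/
def energy (x : Fin n → S) : ℝ :=
  ∑ v, M.nodePot v (x v) + ∑ e : M.Edge, M.edgePot e (x (M.lo e)) (x (M.hi e))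

/-- `x` is a MAP assignment. -/
def IsMAP (x : Fin n → S) : Prop := ∀ y, M.energy y ≤ M.energy x

/-- The graph `(V, E \ B)`. -/
def cutGraph (B : Finset M.Edge) : SimpleGraph (Fin n) :=
  M.graph.deleteEdges (Subtype.val '' (B : Set M.Edge))

open Classical in
/-- The sum of the potentials of the vertices and the remaining edges of a connected component of
`(V, E \ B)`. A remaining edge lies in the component of its smaller endpoint. -/
def energyOn (B : Finset M.Edge) (c : (M.cutGraph B).ConnectedComponent) (x : Fin n → S) : ℝ :=
  ∑ v with (M.cutGraph B).connectedComponentMk v = c, M.nodePot v (x v) +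
    ∑ e : M.Edge with e ∉ B ∧ (M.cutGraph B).connectedComponentMk (M.lo e) = c,
      M.edgePot e (x (M.lo e)) (x (M.hi e))

/-- `x` restricts to an exact MAP assignment of every connected component of `(V, E \ B)`. -/
def IsComponentMAP (B : Finset M.Edge) (x : Fin n → S) : Prop :=
  ∀ (c : (M.cutGraph B).ConnectedComponent) (y : Fin n → S),
    M.energyOn B c y ≤ M.energyOn B c x

/-- `μ` is a joint law of the pair (removed edges, output assignment) of the algorithm Mode that
uses `Db-dim(p, K)` on the graph of edges as edge decomposition: the removed edges have the law of
the decomposition, and the output is an exact MAP assignment on every remaining component (no rule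
for breaking ties is fixed). -/
def IsModeLaw (p : ℝ) (hp : p ∈ Set.Icc (0 : ℝ) 1) (K : ℕ)
    (μ : PMF (Finset M.Edge × (Fin n → S))) : Prop :=
  μ.map Prod.fst = dbDim M.graph.lineGraph p hp K ∧
    ∀ z ∈ μ.support, M.IsComponentMAP z.1 z.2

end MRF

/-! ### The algorithm with a step count

Below, the algorithm is written with an explicit count of elementary steps, for a random-access
machine that adds and compares real numbers in one step. Every expression outside a call
of another counted function is a bounded number of the following elementary operations, and is
paid for by `tick`: matching on a list or putting an element in front of it; reading or
overwriting an array entry (arrays are functions, the write is `Function.update`); inserting into,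
deleting from, testing emptiness of or membership in a set of vertices or edges, or drawing a
uniformly random element of it (such a set is kept as an array of its elements together with the
array of their positions); arithmetic and comparison. A graph is given by the list of its vertices
and edges and the lists of edges at each vertex, an edge by its two endpoints. -/

/-- A value together with the number of steps spent to compute it. -/
structure Timed (α : Type) where
  val : α
  time : ℕ

instance : Monad Timed where
  pure a := ⟨a, 0⟩
  bind a f := ⟨(f a.val).val, a.time + (f a.val).time⟩

/-- Spend `k` steps. -/
def tick (k : ℕ) : Timed Unit := ⟨(), k⟩

/-- Sequential composition of randomized computations with a step count. -/
def andThen {α β : Type} (a : PMF (Timed α)) (f : α → PMF (Timed β)) : PMF (Timed β) :=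
  a.bind fun r => (f r.val).map fun r' => ⟨r'.val, r.time + r'.time⟩

section Search

variable {V : Type} [DecidableEq V]

/-- Put the vertices of a list that have not been seen into `next`, and mark them as seen. The
third step pays for unmarking the vertex after the search. -/
def scan : List V → Finset V → List V → Timed (Finset V × List V)
  | [], seen, next => do
    tick 1
    return (seen, next)
  | w :: l, seen, next => do
    tick 3
    if w ∈ seen then scan l seen next else scan l (insert w seen) (w :: next)

/-- One layer of breadth-first search: the unseen neighbours of the vertices of a list. -/
def expand (adj : V → List V) : List V → Finset V → List V → Timed (Finset V × List V)
  | [], seen, next => do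
    tick 1
    return (seen, next)
  | v :: l, seen, next => do
    tick 1
    let r ← scan (adj v) seen next
    expand adj l r.1 r.2

/-- Move the white vertices of a list from the white set to the set `painted`. -/
def paint : List V → Finset V → Finset V → Timed (Finset V × Finset V)
  | [], white, painted => do
    tick 1
    return (white, painted)
  | v :: l, white, painted => do
    tick 3
    if v ∈ white then paint l (white.erase v) (insert v painted) else paint l white painted

/-- Breadth-first search to depth `q`, starting from the current layer: the white vertices in the
layers before the last one turn red, those in the last one turn blue. The result is the new white,
blue and red sets. -/
def sweep (adj : V → List V) : ℕ → List V → Finset V → Finset V → Finset V → Finset V →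
    Timed (Finset V × Finset V × Finset V)
  | 0, layer, _, white, blue, red => do
    tick 1
    let r ← paint layer white blue
    return (r.1, r.2, red)
  | q + 1, layer, seen, white, blue, red => do
    tick 1
    let r ← paint layer white red
    let s ← expand adj layer seen []
    sweep adj q s.2 s.1 r.1 blue r.2

/-- The decomposition loop, for at most the given number of iterations. Drawing a number from the
law `Q` on `{1, …, K}` is charged `K` steps. -/
def dbDimRun (adj : V → List V) (Q : PMF ℕ) (K : ℕ) :
    ℕ → Finset V → Finset V → Finset V → PMF (Timed (Finset V))
  | 0, _, blue, _ => PMF.pure ⟨blue, 1⟩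
  | k + 1, white, blue, red =>
    if h : white.Nonempty then
      (PMF.uniformOfFinset white h).bind fun u =>
        Q.bind fun q =>
          andThen
            (PMF.pure (do
              tick (K + 4)
              sweep adj q [u] {u} white blue red))
            fun r => dbDimRun adj Q K k r.1 r.2.1 r.2.2
    else PMF.pure ⟨blue, 1⟩

/-- The vertices reached by breadth-first search from the current layer, in front of `acc`, and
the set of all vertices seen so far. -/
def explore (adj : V → List V) : ℕ → List V → Finset V → List V → Timed (Finset V × List V)
  | 0, _, seen, acc => do
    tick 1
    return (seen, acc)
  | _ + 1, [], seen, acc => do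
    tick 1
    return (seen, acc)
  | k + 1, v :: l, seen, acc => do
    tick (2 + l.length)
    let r ← expand adj (v :: l) seen []
    explore adj k r.2 r.1 ((v :: l) ++ acc)

end Search

namespace MRF

variable {n : ℕ} {S : Type} (M : MRF n S)

open Classical in
/-- The input list of the edges at a vertex. -/
def inc (v : Fin n) : List M.Edge :=
  (Finset.univ.filter fun e : M.Edge => v ∈ e.1).toList

/-- The elements of a list of edges other than `e`, in front of `acc`. -/
def copyOthers (e : M.Edge) : List M.Edge → List M.Edge → Timed (List M.Edge)
  | [], acc => do
    tick 1
    return acc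
  | f :: l, acc => do
    tick 2
    if f = e then copyOthers e l acc else copyOthers e l (f :: acc)

/-- The neighbour lists of the graph of edges, for the edges in a list. -/
def edgeAdj : List M.Edge → (M.Edge → List M.Edge) → Timed (M.Edge → List M.Edge)
  | [], tab => do
    tick 1
    return tab
  | e :: l, tab => do
    tick 2
    let a ← M.copyOthers e (M.inc (M.lo e)) []
    let b ← M.copyOthers e (M.inc (M.hi e)) a
    edgeAdj l (Function.update tab e b)

/-- The edge decomposition: set up the graph of edges and the initial white set, then run the
decomposition loop (each iteration colours at least one edge, so `|E|` iterations suffice). -/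
def decompRun (p : ℝ) (hp : p ∈ Set.Icc (0 : ℝ) 1) (K : ℕ) : PMF (Timed (Finset M.Edge)) :=
  andThen
    (PMF.pure (do
      tick (1 + 3 * Fintype.card M.Edge)
      M.edgeAdj Finset.univ.toList fun _ => []))
    fun adj => dbDimRun adj (stopLaw p hp K) K (Fintype.card M.Edge) Finset.univ ∅ ∅

/-- From a list of edges at `v`, collect the other endpoints of the edges outside `B`, and those
edges outside `B` of which `v` is the smaller endpoint. -/
def keepRow (B : Finset M.Edge) (v : Fin n) :
    List M.Edge → List (Fin n) → List M.Edge → Timed (List (Fin n) × List M.Edge)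
  | [], nb, low => do
    tick 1
    return (nb, low)
  | e :: l, nb, low => do
    tick 4
    if e ∈ B then keepRow B v l nb low
    else if M.lo e = v then keepRow B v l (M.hi e :: nb) (e :: low)
    else keepRow B v l (M.lo e :: nb) low

/-- The tables of `keepRow` for the vertices in a list. -/
def keepTable (B : Finset M.Edge) : List (Fin n) → (Fin n → List (Fin n) × List M.Edge) →
    Timed (Fin n → List (Fin n) × List M.Edge)
  | [], tab => do
    tick 1
    return tab
  | v :: l, tab => do
    tick 2
    let r ← M.keepRow B v (M.inc v) [] []
    keepTable B l (Function.update tab v r)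

/-- Add the potentials of a list of edges to `acc`. -/
def edgeScore (x : Fin n → S) : List M.Edge → ℝ → Timed ℝ
  | [], acc => do
    tick 1
    return acc
  | e :: l, acc => do
    tick 2
    edgeScore x l (acc + M.edgePot e (x (M.lo e)) (x (M.hi e)))

/-- Add the potentials of a list of vertices and of the edges in their rows of `low` to `acc`. -/
def score (low : Fin n → List M.Edge) (x : Fin n → S) : List (Fin n) → ℝ → Timed ℝ
  | [], acc => do
    tick 1
    return acc
  | v :: l, acc => do
    tick 2
    let s ← M.edgeScore x (low v) (acc + M.nodePot v (x v))
    score low x l s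

open Classical in
/-- Exhaustive search over the values at a list of vertices of the component `comp`, keeping the
best score and assignment so far. Recording a new best assignment means copying its values on
`comp`: elsewhere it never changes during the search. -/
def exhaust (letters : List S) (low : Fin n → List M.Edge) (comp : List (Fin n)) :
    List (Fin n) → (Fin n → S) → ℝ × (Fin n → S) → Timed (ℝ × (Fin n → S))
  | [], x, best => do
    tick 2
    let s ← M.score low x comp 0
    if best.1 < s then
      tick comp.length
      return (s, x)
    else
      return best
  | v :: l, x, best => do
    tick 1
    letters.foldlM
      (fun b a => do
        tick 2
        exhaust letters low comp l (Function.update x v a) b) best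

/-- Go through a list of vertices; for each one that has not been seen, find its connected
component and an exact MAP assignment of the component. The steps proportional to the size of the
component pay for copying the assignment into the record of the search and back. -/
def solve (letters : List S) (tab : Fin n → List (Fin n) × List M.Edge) :
    List (Fin n) → Finset (Fin n) → (Fin n → S) → Timed (Fin n → S)
  | [], _, x => do
    tick 1
    return x
  | v :: l, seen, x => do
    tick 3
    if v ∈ seen then solve letters tab l seen x
    else do
      let r ← explore (fun w => (tab w).1) n [v] (insert v seen) []
      tick (3 * r.2.length)
      let s ← M.score (fun w => (tab w).2) x r.2 0
      let best ← M.exhaust letters (fun w => (tab w).2) r.2 r.2 x (s, x)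
      solve letters tab l r.1 best.2

/-- The algorithm Mode with `Db-dim(p, K)` on the graph of edges, with its step count. It returns
the removed edges and the assignment. -/
def modeRun [Fintype S] [Nonempty S] (p : ℝ) (hp : p ∈ Set.Icc (0 : ℝ) 1) (K : ℕ) :
    PMF (Timed (Finset M.Edge × (Fin n → S))) :=
  andThen (M.decompRun p hp K) fun B =>
    PMF.pure (do
      tick (1 + 3 * n)
      let tab ← M.keepTable B (List.finRange n) fun _ => ([], [])
      let x ← M.solve Finset.univ.toList tab (List.finRange n) ∅ fun _ => Classical.arbitrary S
      return (B, x))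

end MRF

/-! ### The parameters -/

/-- `φ = ε 2^{-ρ-3}`. -/
def rate (ε ρ : ℝ) : ℝ := ε * (2 : ℝ) ^ (-ρ - 3)

lemma rate_mem {ε ρ : ℝ} (h0 : 0 < ε) (h1 : ε < 1) (hρ : 1 ≤ ρ) :
    rate ε ρ ∈ Set.Icc (0 : ℝ) 1 := by
  have h2 : (2 : ℝ) ^ (-ρ - 3) ≤ 1 :=
    Real.rpow_le_one_of_one_le_of_nonpos (by norm_num) (by linarith)
  have h3 : (0 : ℝ) < (2 : ℝ) ^ (-ρ - 3) := by positivity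
  exact ⟨by unfold rate; positivity, by unfold rate; nlinarith⟩

/-- `K(φ, ρ) = (12 ρ / φ) log (24 ρ / φ)`. -/
def radius (φ ρ : ℝ) : ℝ := 12 * ρ / φ * Real.log (24 * ρ / φ)

end ModeAlg

end

/-!
Compare the output of Mode with an arbitrary assignment `y` component by component: the output
loses at most the potentials of `y` on the removed edges, so the expected loss is at most `ε` times
the energy of `y` once every edge is removed with probability at most `ε`.

Follow an edge `e` through the decomposition of the graph of edges. As long as centers are chosen
at distance at least `K` from `e`, a center can cut `e` only if it lies at distance exactly `K` and
`Q = K`. A center at distance `j < K` colours `e` for good if `Q ≥ j`, and given this event `Q = j`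
has conditional probability at most `φ`. Hence `e` is cut with probability at most
`φ + (1 - φ) ^ (K - 1) * N`, where `N` counts the edges at distance `K` from `e`. Doubling makes
`N` polynomial in `K` with exponent of order `ρ`, so the choice of `K` bounds the second term
by `φ`.

For the running time, an uncut edge is coloured by a center within distance `K`, and adjacent uncut
edges share it. A component of the cut graph therefore lies in a ball of `G` of radius `K + 1`,
which has at most `λ ^ (log₂ K + 1)` vertices for the doubling constant `λ`, and this bounds the
exhaustive search. The decomposition itself costs polynomially many steps in `K` and `λ` per edge,
which the same exponential absorbs.
-/

namespace ModeAlg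

section Doubling

variable {V : Type*} (G : SimpleGraph V)

lemma doublingConstant_spec [Finite V] (v : V) (r : ℝ≥0) :
    ∃ s : Finset V, s.card ≤ doublingConstant G ∧ ball G v r ⊆ ⋃ u ∈ s, ball G u (r / 2) := by
  cases nonempty_fintype V
  refine Nat.sInf_mem (s := {k | ∀ (v : V) (r : ℝ≥0), ∃ s : Finset V, s.card ≤ k ∧
    ball G v r ⊆ ⋃ u ∈ s, ball G u (r / 2)}) ⟨Fintype.card V, fun v r => ?_⟩ v r
  refine ⟨Finset.univ, le_rfl, fun w hw => Set.mem_iUnion₂.2 ⟨w, Finset.mem_univ w, ?_⟩⟩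
  have hr : 0 < r := ENNReal.coe_pos.1 (bot_le.trans_lt hw)
  simpa [ball] using hr.ne'

lemma one_le_doublingConstant [Finite V] [Nonempty V] : 1 ≤ doublingConstant G := by
  obtain ⟨v⟩ := ‹Nonempty V›
  obtain ⟨s, hs, hb⟩ := doublingConstant_spec G v 1
  have hv : v ∈ ball G v 1 := by simp [ball]
  obtain ⟨u, hu, -⟩ := Set.mem_iUnion₂.1 (hb hv)
  exact (Finset.card_pos.2 ⟨u, hu⟩).trans_le hs

lemma ball_natCast (v : V) (m : ℕ) : ball G v m = G.ball v m := by
  ext w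
  rw [SimpleGraph.mem_ball, SimpleGraph.edist_comm, ball, Set.mem_ofPred_eq,
    ENNReal.coe_natCast, ← ENat.toENNReal_coe, ENat.toENNReal_lt]

lemma ncard_ball_two_pow_le [Finite V] (v : V) (k : ℕ) :
    (G.ball v (2 ^ k : ℕ)).ncard ≤ doublingConstant G ^ k := by
  induction k generalizing v with
  | zero => simp
  | succ k ih =>
    obtain ⟨s, hs, hb⟩ := doublingConstant_spec G v (2 ^ (k + 1) : ℕ)
    have hhalf : ((2 ^ (k + 1) : ℕ) : ℝ≥0) / 2 = (2 ^ k : ℕ) := by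
      push_cast
      rw [pow_succ, mul_div_cancel_right₀ _ two_ne_zero]
    simp only [hhalf, ball_natCast] at hb
    calc (G.ball v (2 ^ (k + 1) : ℕ)).ncard
        ≤ (⋃ u ∈ s, G.ball u (2 ^ k : ℕ)).ncard := Set.ncard_le_ncard hb
      _ ≤ ∑ u ∈ s, (G.ball u (2 ^ k : ℕ)).ncard := s.set_ncard_biUnion_le _
      _ ≤ s.card * doublingConstant G ^ k := s.sum_le_card_nsmul _ _ fun u _ => ih u
      _ ≤ doublingConstant G ^ (k + 1) := by
        rw [pow_succ']
        gcongr

lemma ncard_ball_succ_le [Finite V] (v : V) (K : ℕ) :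
    (G.ball v (K + 1 : ℕ)).ncard ≤ doublingConstant G ^ (Nat.log 2 K + 1) :=
  (Set.ncard_le_ncard (SimpleGraph.ball_mono
    (by exact_mod_cast Nat.lt_pow_succ_log_self one_lt_two K))).trans
    (ncard_ball_two_pow_le G v _)

lemma ncard_edgesAt_le [Finite V] (v : V) :
    {e : G.edgeSet | v ∈ e.1}.ncard ≤ doublingConstant G := by
  have hpre : {e : G.edgeSet | v ∈ e.1} = Subtype.val ⁻¹' G.incidenceSet v := by
    ext e
    simp [SimpleGraph.incidenceSet]
  calc {e : G.edgeSet | v ∈ e.1}.ncard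
      = (G.incidenceSet v).ncard := by
        rw [hpre, Set.ncard_preimage_of_injective_subset_range Subtype.val_injective]
        simpa using G.incidenceSet_subset v
    _ = (G.neighborSet v).ncard := by
        classical exact Set.ncard_congr' (G.incidenceSetEquivNeighborSet v)
    _ ≤ (G.ball v (2 ^ 1 : ℕ)).ncard := Set.ncard_le_ncard (by simp)
    _ ≤ doublingConstant G := (ncard_ball_two_pow_le G v 1).trans_eq (pow_one _)

lemma card_edgeSet_le [Finite V] : Nat.card G.edgeSet ≤ Nat.card V * doublingConstant G := by
  cases nonempty_fintype V
  have hcover : ⋃ v : V, {e : G.edgeSet | v ∈ e.1} = Set.univ :=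
    Set.eq_univ_of_forall fun e => Set.mem_iUnion.2 ⟨_, Sym2.out_fst_mem e.1⟩
  calc Nat.card G.edgeSet = (⋃ v : V, {e : G.edgeSet | v ∈ e.1}).ncard := by
        rw [hcover, Set.ncard_univ]
    _ ≤ ∑ v : V, {e : G.edgeSet | v ∈ e.1}.ncard := Set.ncard_iUnion_le_of_fintype _
    _ ≤ Nat.card V * doublingConstant G := by
        rw [Nat.card_eq_fintype_card]
        exact Finset.sum_le_card_nsmul _ _ _ fun v _ => ncard_edgesAt_le G v

variable {G}

lemma edist_le_one_of_mem_edge (e : G.edgeSet) {v w : V} (hv : v ∈ e.1) (hw : w ∈ e.1) :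
    G.edist v w ≤ 1 := by
  rw [SimpleGraph.edist_le_one_iff_adj_or_eq, or_iff_not_imp_right]
  intro hne
  rw [← SimpleGraph.mem_edgeSet, ← (Sym2.mem_and_mem_iff hne).1 ⟨hv, hw⟩]
  exact e.2

lemma exists_mem_edist_le_lineGraph_edist (e f : G.edgeSet) {a : V} (ha : a ∈ e.1) :
    ∃ b ∈ f.1, G.edist a b ≤ G.lineGraph.edist e f := by
  have key : ∀ p : G.lineGraph.Walk e f, ∃ b ∈ f.1, G.edist a b ≤ p.length := by
    intro p
    induction p generalizing a with
    | nil => exact ⟨a, ha, by simp⟩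
    | @cons e g f hadj p ih =>
      obtain ⟨-, c, hce, hcg⟩ := hadj
      obtain ⟨b, hb, hcb⟩ := ih hcg
      refine ⟨b, hb, ?_⟩
      calc G.edist a b ≤ G.edist a c + G.edist c b := SimpleGraph.edist_triangle
        _ ≤ 1 + p.length := add_le_add (edist_le_one_of_mem_edge e ha hce) hcb
        _ = (p.length + 1 : ℕ) := by rw [add_comm, Nat.cast_succ]
  by_cases hef : G.lineGraph.Reachable e f
  · obtain ⟨p, hp⟩ := hef.exists_walk_length_eq_edist
    exact hp ▸ key p
  · rw [SimpleGraph.edist_eq_top_of_not_reachable hef]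
    exact ⟨_, Sym2.out_fst_mem f.1, le_top⟩

lemma edist_le_lineGraph_edist_add_one {e f : G.edgeSet} {a b : V} (ha : a ∈ e.1)
    (hb : b ∈ f.1) : G.edist a b ≤ G.lineGraph.edist e f + 1 := by
  obtain ⟨c, hc, hac⟩ := exists_mem_edist_le_lineGraph_edist e f ha
  exact SimpleGraph.edist_triangle.trans (add_le_add hac (edist_le_one_of_mem_edge f hc hb))

variable (G) in
lemma ncard_lineGraph_ball_succ_le [Finite V] (e : G.edgeSet) (K : ℕ) :
    (G.lineGraph.ball e (K + 1 : ℕ)).ncard ≤ doublingConstant G ^ (Nat.log 2 K + 2) := by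
  obtain ⟨a, ha⟩ : ∃ a, a ∈ e.1 := ⟨_, Sym2.out_fst_mem e.1⟩
  set s := (Set.toFinite (G.ball a (K + 1 : ℕ))).toFinset with hs
  have hsub : G.lineGraph.ball e (K + 1 : ℕ) ⊆ ⋃ v ∈ s, {f : G.edgeSet | v ∈ f.1} := by
    intro f hf
    obtain ⟨b, hb, hab⟩ := exists_mem_edist_le_lineGraph_edist e f ha
    refine Set.mem_iUnion₂.2 ⟨b, ?_, hb⟩
    rw [hs, Set.Finite.mem_toFinset, SimpleGraph.mem_ball_comm]
    exact hab.trans_lt (SimpleGraph.mem_ball_comm.1 hf)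
  calc (G.lineGraph.ball e (K + 1 : ℕ)).ncard
      ≤ ∑ v ∈ s, {f : G.edgeSet | v ∈ f.1}.ncard :=
        (Set.ncard_le_ncard hsub).trans (s.set_ncard_biUnion_le _)
    _ ≤ s.card * doublingConstant G :=
        s.sum_le_card_nsmul _ _ fun v _ => ncard_edgesAt_le G v
    _ ≤ doublingConstant G ^ (Nat.log 2 K + 1) * doublingConstant G := by
        gcongr
        rw [hs, ← Set.ncard_eq_toFinset_card]
        exact ncard_ball_succ_le G a K

end Doubling

section Decomposition

variable {V : Type} (H : SimpleGraph V) (Q : PMF ℕ)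

open Classical in
/-- The vertices of `W` outside the closed ball of radius `q` around `u`: the white vertices that
stay white in a step of the decomposition. -/
noncomputable def outerPart (W : Finset V) (u : V) (q : ℕ) : Finset V :=
  W.filter fun w => (q : ℕ∞) < H.edist u w

open Classical in
/-- The vertices of `W` at distance exactly `q` from `u`: the white vertices that turn blue in a
step of the decomposition. -/
noncomputable def spherePart (W : Finset V) (u : V) (q : ℕ) : Finset V :=
  W.filter fun w => H.edist u w = q

variable {H} in
@[simp] lemma mem_outerPart {W : Finset V} {u w : V} {q : ℕ} :
    w ∈ outerPart H W u q ↔ w ∈ W ∧ (q : ℕ∞) < H.edist u w := by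
  classical exact Finset.mem_filter

variable {H} in
@[simp] lemma mem_spherePart {W : Finset V} {u w : V} {q : ℕ} :
    w ∈ spherePart H W u q ↔ w ∈ W ∧ H.edist u w = q := by
  classical exact Finset.mem_filter

lemma outerPart_subset (W : Finset V) (u : V) (q : ℕ) : outerPart H W u q ⊆ W :=
  fun _ hw => (mem_outerPart.1 hw).1

variable {H} in
lemma outerPart_outerPart {W : Finset V} {u : V} {k m : ℕ} (h : k ≤ m) :
    outerPart H (outerPart H W u k) u m = outerPart H W u m := by
  ext x
  simp only [mem_outerPart, and_assoc, and_congr_right_iff, and_iff_right_iff_imp]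
  exact fun _ hx => hx.trans_le' (by exact_mod_cast h)

variable {H} in
lemma spherePart_outerPart {W : Finset V} {u : V} {k m : ℕ} (h : k < m) :
    spherePart H (outerPart H W u k) u m = spherePart H W u m := by
  ext x
  simp only [mem_spherePart, mem_outerPart, and_assoc, and_congr_right_iff, and_iff_right_iff_imp]
  rintro _ hx
  rw [hx]
  exact_mod_cast h

lemma card_outerPart_lt {W : Finset V} {u : V} (hu : u ∈ W) (q : ℕ) :
    (outerPart H W u q).card < W.card :=
  Finset.card_lt_card ((Finset.ssubset_iff_of_subset (outerPart_subset H W u q)).2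
    ⟨u, hu, by simp⟩)

lemma uniformOfFintype_map_val {α : Type*} (s : Finset α) (hs : s.Nonempty) [Nonempty s] :
    (PMF.uniformOfFintype s).map Subtype.val = PMF.uniformOfFinset s hs := by
  ext a
  rw [PMF.map_apply, PMF.uniformOfFinset_apply]
  split_ifs with ha
  · rw [tsum_eq_single ⟨a, ha⟩ fun b hb => if_neg fun hab => hb (Subtype.ext hab.symm)]
    simp
  · exact ENNReal.tsum_eq_zero.2 fun b => if_neg (by rintro rfl; exact ha b.2)

open Classical in
lemma dbDimFrom_of_nonempty {W : Finset V} (hW : W.Nonempty) (B : Finset V) :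
    dbDimFrom H Q W B = (PMF.uniformOfFinset W hW).bind fun u => Q.bind fun q =>
      dbDimFrom H Q (outerPart H W u q) (B ∪ spherePart H W u q) := by
  have : Nonempty W := hW.to_subtype
  rw [dbDimFrom, dif_pos hW, ← uniformOfFintype_map_val W hW, PMF.bind_map]
  rfl

@[simp] lemma dbDimFrom_empty (B : Finset V) : dbDimFrom H Q ∅ B = PMF.pure B := by
  rw [dbDimFrom, dif_neg Finset.not_nonempty_empty]

variable {H Q}

open Classical in
lemma dbDimFrom_support_induction {B' : Finset V} {motive : Finset V → Finset V → Prop}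
    (empty : motive ∅ B')
    (step : ∀ W B : Finset V, ∀ u ∈ W, ∀ q ∈ Q.support,
      B' ∈ (dbDimFrom H Q (outerPart H W u q) (B ∪ spherePart H W u q)).support →
      motive (outerPart H W u q) (B ∪ spherePart H W u q) → motive W B)
    {W B : Finset V} (h : B' ∈ (dbDimFrom H Q W B).support) : motive W B := by
  induction hk : W.card using Nat.strong_induction_on generalizing W B with
  | _ k ih =>
    rcases W.eq_empty_or_nonempty with rfl | hW
    · rw [dbDimFrom_empty, PMF.mem_support_pure_iff] at h
      exact h ▸ empty
    · simp only [dbDimFrom_of_nonempty H Q hW, PMF.mem_support_bind_iff,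
        PMF.mem_support_uniformOfFinset_iff] at h
      obtain ⟨u, hu, q, hq, h⟩ := h
      exact step W B u hu q hq h (ih _ (hk ▸ card_outerPart_lt H hu q) h rfl)

open Classical in
lemma subset_of_mem_support_dbDimFrom {W B B' : Finset V}
    (h : B' ∈ (dbDimFrom H Q W B).support) : B ⊆ B' ∧ B' ⊆ B ∪ W := by
  refine dbDimFrom_support_induction (motive := fun W B => B ⊆ B' ∧ B' ⊆ B ∪ W)
    (by simp) ?_ h
  rintro W B u - q - - ⟨hlow, hup⟩
  refine ⟨Finset.subset_union_left.trans hlow, hup.trans fun x hx => ?_⟩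
  simp only [Finset.mem_union, mem_outerPart, mem_spherePart] at hx ⊢
  tauto

/-- Uncut vertices turn red, and adjacent ones do so in the same step, around the same center. -/
lemma exists_center_of_mem_support {K : ℕ} (hQ : ∀ q ∈ Q.support, q ≤ K) {W B B' : Finset V}
    (h : B' ∈ (dbDimFrom H Q W B).support) :
    ∃ c : V → V, (∀ e ∈ W, e ∉ B' → H.edist (c e) e < K) ∧
      ∀ e ∈ W, ∀ f ∈ W, e ∉ B' → f ∉ B' → H.Adj e f → c e = c f := by
  classical
  refine dbDimFrom_support_induction (motive := fun W _ => ∃ c : V → V,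
    (∀ e ∈ W, e ∉ B' → H.edist (c e) e < K) ∧
      ∀ e ∈ W, ∀ f ∈ W, e ∉ B' → f ∉ B' → H.Adj e f → c e = c f) ⟨id, by simp, by simp⟩ ?_ h
  rintro W B u - q hq hB' ⟨c, hdist, hconst⟩
  have hred : ∀ e ∈ W, e ∉ B' → e ∉ outerPart H W u q → H.edist u e < q := by
    intro e he heB hout
    refine lt_of_le_of_ne (not_lt.1 fun hlt => hout (mem_outerPart.2 ⟨he, hlt⟩)) fun heq => heB ?_
    exact (subset_of_mem_support_dbDimFrom hB').1
      (Finset.mem_union_right _ (mem_spherePart.2 ⟨he, heq⟩))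
  have hside : ∀ e ∈ W, e ∉ B' → ∀ f, H.Adj e f → e ∉ outerPart H W u q →
      f ∉ outerPart H W u q := by
    intro e he heB f hef hout hf
    refine (mem_outerPart.1 hf).2.not_ge ?_
    calc H.edist u f ≤ H.edist u e + H.edist e f := SimpleGraph.edist_triangle
      _ = H.edist u e + 1 := by rw [SimpleGraph.edist_eq_one_iff_adj.2 hef]
      _ ≤ q := Order.add_one_le_of_lt (hred e he heB hout)
  refine ⟨fun e => if e ∈ outerPart H W u q then c e else u, fun e he heB => ?_,
    fun e he f hf heB hfB hef => ?_⟩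
  · by_cases hout : e ∈ outerPart H W u q
    · simpa only [hout, if_true] using hdist e hout heB
    · simp only [hout, if_false]
      exact (hred e he heB hout).trans_le (by exact_mod_cast hQ q hq)
  · have hiff : e ∈ outerPart H W u q ↔ f ∈ outerPart H W u q :=
      not_iff_not.1 ⟨hside e he heB f hef, hside f hf hfB e hef.symm⟩
    by_cases hout : e ∈ outerPart H W u q
    · simpa only [hout, hiff.1 hout, if_true] using hconst e hout f (hiff.1 hout) heB hfB hef
    · simp only [hout, mt hiff.2 hout, if_false]

end Decomposition

section CutProbability

lemma toOuterMeasure_Iio_add_Ici (Q : PMF ℕ) (j : ℕ) :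
    Q.toOuterMeasure (Set.Iio j) + Q.toOuterMeasure (Set.Ici j) = 1 := by
  simp only [PMF.toOuterMeasure_apply]
  rw [← ENNReal.tsum_add, ← Q.tsum_coe]
  refine tsum_congr fun q => ?_
  rcases lt_or_ge q j with h | h <;> simp [h, not_le.2, not_lt.2]

/-- `hQ` says that `Q` equals `j` with conditional probability at most `p`, given `Q ≥ j`. -/
lemma tsum_mul_le_of_hazard_le (Q : PMF ℕ) {g : ℕ → ℝ≥0∞} {p b : ℝ≥0∞} {j : ℕ}
    (hQ : Q j ≤ p * Q.toOuterMeasure (Set.Ici j)) (hpb : p ≤ b) (hlt : ∀ q < j, g q ≤ b)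
    (hj : g j ≤ 1) (hgt : ∀ q, j < q → g q = 0) : ∑' q, Q q * g q ≤ b := by
  calc ∑' q, Q q * g q
      ≤ ∑' q, ((Set.Iio j).indicator Q q * b + if q = j then Q j else 0) := by
        refine ENNReal.tsum_le_tsum fun q => ?_
        rcases lt_trichotomy q j with h | rfl | h
        · simpa [h, h.ne] using mul_le_mul_right (hlt q h) (Q q)
        · simpa using mul_le_of_le_one_right' hj
        · simp [hgt q h]
    _ = Q.toOuterMeasure (Set.Iio j) * b + Q j := by
        rw [ENNReal.tsum_add, ENNReal.tsum_mul_right, tsum_ite_eq, PMF.toOuterMeasure_apply]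
    _ ≤ Q.toOuterMeasure (Set.Iio j) * b + Q.toOuterMeasure (Set.Ici j) * b := by
        rw [mul_comm _ b, mul_comm _ b]
        gcongr
        exact hQ.trans (by gcongr)
    _ = b := by rw [← add_mul, toOuterMeasure_Iio_add_Ici, one_mul]

lemma tsum_mul_le_add_apply (Q : PMF ℕ) {g : ℕ → ℝ≥0∞} {c : ℝ≥0∞} {K : ℕ}
    (hQ : ∀ q ∈ Q.support, q ≤ K) (hlt : ∀ q < K, g q ≤ c) (hK : g K ≤ 1) :
    ∑' q, Q q * g q ≤ c + Q K := by
  calc ∑' q, Q q * g q ≤ ∑' q, (Q q * c + if q = K then Q K else 0) := by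
        refine ENNReal.tsum_le_tsum fun q => ?_
        rcases lt_trichotomy q K with h | rfl | h
        · simpa [h.ne] using mul_le_mul_right (hlt q h) (Q q)
        · simpa using (mul_le_of_le_one_right' hK).trans le_add_self
        · simp [(PMF.apply_eq_zero_iff Q q).2 fun hq => h.not_ge (hQ q hq)]
    _ = c + Q K := by
        rw [ENNReal.tsum_add, ENNReal.tsum_mul_right, tsum_ite_eq, PMF.tsum_coe, one_mul]

lemma tsum_mul_le_of_support (Q : PMF ℕ) {g : ℕ → ℝ≥0∞} {b : ℝ≥0∞}
    (hg : ∀ q ∈ Q.support, g q ≤ b) : ∑' q, Q q * g q ≤ b := by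
  calc ∑' q, Q q * g q ≤ ∑' q, Q q * b := by
        refine ENNReal.tsum_le_tsum fun q => ?_
        by_cases hq : q ∈ Q.support
        · gcongr
          exact hg q hq
        · simp [(PMF.apply_eq_zero_iff Q q).2 hq]
    _ = b := by rw [ENNReal.tsum_mul_right, PMF.tsum_coe, one_mul]

variable {V : Type} (H : SimpleGraph V) (Q : PMF ℕ)

/-- The probability that the vertex `w` is removed when the decomposition is run from the state
with white set `W` and blue set `B`. -/
noncomputable def cutProb (W B : Finset V) (w : V) : ℝ≥0∞ :=
  (dbDimFrom H Q W B).toOuterMeasure {B' | w ∈ B'}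

lemma cutProb_le_one (W B : Finset V) (w : V) : cutProb H Q W B w ≤ 1 :=
  (MeasureTheory.measure_mono (Set.subset_univ _)).trans_eq
    ((PMF.toOuterMeasure_apply_eq_one_iff _ _).2 (Set.subset_univ _))

lemma cutProb_eq_zero {W B : Finset V} {w : V} (hW : w ∉ W) (hB : w ∉ B) :
    cutProb H Q W B w = 0 := by
  classical
  rw [cutProb, PMF.toOuterMeasure_apply_eq_zero_iff, Set.disjoint_left]
  intro B' hB' hw
  exact (Finset.mem_union.1 ((subset_of_mem_support_dbDimFrom hB').2 hw)).elim hB hW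

open Classical in
lemma cutProb_le_of_forall_center {W B : Finset V} (hW : W.Nonempty) {w : V} {b : ℝ≥0∞}
    (h : ∀ u ∈ W,
      ∑' q, Q q * cutProb H Q (outerPart H W u q) (B ∪ spherePart H W u q) w ≤ b) :
    cutProb H Q W B w ≤ b := by
  rw [cutProb, dbDimFrom_of_nonempty H Q hW, PMF.toOuterMeasure_bind_apply]
  calc _ ≤ ∑' u, PMF.uniformOfFinset W hW u * b := by
        refine ENNReal.tsum_le_tsum fun u => ?_
        by_cases hu : u ∈ W
        · gcongr
          rw [PMF.toOuterMeasure_bind_apply]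
          exact h u hu
        · simp [PMF.uniformOfFinset_apply, hu]
    _ = b := by rw [ENNReal.tsum_mul_right, PMF.tsum_coe, one_mul]

variable {H Q}

/-- A center closer than `K` cuts `w` only if `Q` stops exactly at its distance to `w`, which has
conditional probability at most `p`; a center at distance `K` cuts `w` with probability at most
`Q K` and then leaves the sphere of radius `K` around `w`. -/
lemma cutProb_le {K : ℕ} {p : ℝ≥0∞} (hQ : ∀ q ∈ Q.support, q ≤ K)
    (hazard : ∀ j < K, Q j ≤ p * Q.toOuterMeasure (Set.Ici j)) {W B : Finset V} {w : V}
    (hw : w ∈ W) (hB : w ∉ B) :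
    cutProb H Q W B w ≤ p + Q K * (spherePart H W w K).card := by
  classical
  induction hk : W.card using Nat.strong_induction_on generalizing W B with
  | _ k ih =>
    refine cutProb_le_of_forall_center H Q ⟨w, hw⟩ fun u hu => ?_
    have hwhite : ∀ {S : Finset V} (q : ℕ), (q : ℕ∞) < H.edist u w →
        spherePart H (outerPart H W u q) w K ⊆ S →
        cutProb H Q (outerPart H W u q) (B ∪ spherePart H W u q) w ≤ p + Q K * S.card := by
      intro S q hq hS
      refine (ih _ (hk ▸ card_outerPart_lt H hu q) (by simp [hw, hq])
        (by simp [hB, hq.ne']) rfl).trans ?_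
      gcongr
    have hmono : ∀ q : ℕ, spherePart H (outerPart H W u q) w K ⊆ spherePart H W w K :=
      fun q x hx => mem_spherePart.2 ((mem_spherePart.1 hx).imp_left
        fun h => outerPart_subset H W u q h)
    rcases lt_or_ge (K : ℕ∞) (H.edist u w) with hfar | hnear
    · exact tsum_mul_le_of_support Q fun q hq =>
        hwhite q (hfar.trans_le' (by exact_mod_cast hQ q hq)) (hmono q)
    obtain ⟨j, hj⟩ := ENat.ne_top_iff_exists.1 (ne_top_of_le_ne_top (ENat.natCast_ne_top K) hnear)
    rw [← hj] at hnear hwhite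
    rcases (Nat.cast_le.1 hnear).lt_or_eq with hjK | rfl
    · refine tsum_mul_le_of_hazard_le Q (hazard j hjK) le_self_add
        (fun q hq => hwhite q (by exact_mod_cast hq) (hmono q)) (cutProb_le_one ..)
        fun q hq => cutProb_eq_zero H Q ?_ ?_
      · simp [← hj, hq.le]
      · simp [hB, ← hj, hq.ne]
    · have huS : u ∈ spherePart H W w j := by simp [hu, H.edist_comm (u := w), hj]
      refine (tsum_mul_le_add_apply Q hQ (c := p + Q j * ((spherePart H W w j).erase u).card)
        (fun q hq => hwhite q (by exact_mod_cast hq) ?_) (cutProb_le_one ..)).trans_eq ?_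
      · exact fun x hx => Finset.mem_erase.2 ⟨by rintro rfl; simp at hx, hmono q hx⟩
      · rw [← Finset.card_erase_add_one huS]
        push_cast
        ring

end CutProbability

section StopLaw

variable {p : ℝ} (hp : p ∈ Set.Icc (0 : ℝ) 1)

lemma stopLaw_apply (K i : ℕ) : stopLaw p hp K i = ENNReal.ofReal (stopMass p K i) := rfl

lemma stopLaw_self (K : ℕ) : stopLaw p hp K K = ENNReal.ofReal ((1 - p) ^ (K - 1)) := by
  simp [stopLaw_apply, stopMass]

lemma le_of_mem_support_stopLaw {K q : ℕ} (hq : q ∈ (stopLaw p hp K).support) : q ≤ K := by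
  contrapose! hq
  simp [stopLaw_apply, stopMass, hq.ne', hq.not_gt]

lemma sum_Ico_stopMass (p : ℝ) {j K : ℕ} (hj : 1 ≤ j) (hjK : j ≤ K) :
    ∑ i ∈ Finset.Ico j (K + 1), stopMass p K i = (1 - p) ^ (j - 1) := by
  induction hjK using Nat.decreasingInduction with
  | self => simp [stopMass]
  | of_succ j hjK ih =>
    rw [Finset.sum_eq_sum_Ico_succ_bot (by omega), ih (by omega), stopMass, if_pos ⟨hj, hjK⟩]
    obtain ⟨i, rfl⟩ := Nat.exists_eq_add_of_le' hj
    simp only [Nat.add_sub_cancel]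
    ring

lemma ofReal_pow_le_stopLaw_Ici {j K : ℕ} (hj : 1 ≤ j) (hjK : j ≤ K) :
    ENNReal.ofReal ((1 - p) ^ (j - 1)) ≤ (stopLaw p hp K).toOuterMeasure (Set.Ici j) := by
  rw [← sum_Ico_stopMass p hj hjK, ENNReal.ofReal_sum_of_nonneg fun i _ => stopMass_nonneg hp K i,
    PMF.toOuterMeasure_apply]
  calc ∑ i ∈ Finset.Ico j (K + 1), stopLaw p hp K i
      = ∑ i ∈ Finset.Ico j (K + 1), (Set.Ici j).indicator (stopLaw p hp K) i :=
        Finset.sum_congr rfl fun i hi => by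
          rw [Set.indicator_of_mem (Set.mem_Ici.2 (Finset.mem_Ico.1 hi).1)]
    _ ≤ _ := ENNReal.sum_le_tsum _

lemma stopLaw_le_mul_Ici {j K : ℕ} (hj : j < K) :
    stopLaw p hp K j ≤ ENNReal.ofReal p * (stopLaw p hp K).toOuterMeasure (Set.Ici j) := by
  rcases Nat.eq_zero_or_pos j with rfl | hj1
  · simp [stopLaw_apply, stopMass, hj.ne]
  · rw [stopLaw_apply, stopMass, if_pos ⟨hj1, hj⟩, ENNReal.ofReal_mul hp.1]
    gcongr
    exact ofReal_pow_le_stopLaw_Ici hp hj1 hj.le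

end StopLaw

namespace Timed

variable {α β : Type}

@[simp] lemma pure_val (a : α) : (pure a : Timed α).val = a := rfl

@[simp] lemma pure_time (a : α) : (pure a : Timed α).time = 0 := rfl

@[simp] lemma bind_val (a : Timed α) (f : α → Timed β) : (a >>= f).val = (f a.val).val := rfl

@[simp] lemma bind_time (a : Timed α) (f : α → Timed β) :
    (a >>= f).time = a.time + (f a.val).time := rfl

end Timed

@[simp] lemma tick_time (k : ℕ) : (tick k).time = k := rfl

lemma map_val_andThen {α β : Type} (a : PMF (Timed α)) (f : α → PMF (Timed β)) :
    (andThen a f).map Timed.val = (a.map Timed.val).bind fun x => (f x).map Timed.val := by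
  simp only [andThen, PMF.map_bind, PMF.bind_map, PMF.map_comp]
  rfl

lemma mem_support_andThen {α β : Type} {a : PMF (Timed α)} {f : α → PMF (Timed β)}
    {r : Timed β} : r ∈ (andThen a f).support ↔
      ∃ x ∈ a.support, ∃ y ∈ (f x.val).support, r = ⟨y.val, x.time + y.time⟩ := by
  simp only [andThen, PMF.mem_support_bind_iff, PMF.mem_support_map_iff, eq_comm]

lemma edist_le_succ_iff {V : Type*} {H : SimpleGraph V} {u y : V} {k : ℕ} :
    H.edist u y ≤ (k + 1 : ℕ) ↔ H.edist u y ≤ k ∨ ∃ v, H.edist u v = k ∧ H.Adj v y := by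
  have htri : ∀ {v}, H.Adj v y → H.edist u y ≤ H.edist u v + 1 := fun {v} hv =>
    (SimpleGraph.edist_triangle (v := v)).trans_eq (by rw [SimpleGraph.edist_eq_one_iff_adj.2 hv])
  refine ⟨fun hle => or_iff_not_imp_left.2 fun hgt => ?_, ?_⟩
  · have heq : H.edist y u = (k + 1 : ℕ) := by
      rw [SimpleGraph.edist_comm]
      exact le_antisymm hle (by exact_mod_cast Order.add_one_le_of_lt (not_le.1 hgt))
    obtain ⟨p, hp⟩ := SimpleGraph.exists_walk_of_edist_eq_coe heq
    cases p with
    | nil => simp at hp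
    | @cons _ v _ hyv p =>
      refine ⟨v, le_antisymm ?_ (not_lt.1 fun hlt => hgt ?_), hyv.symm⟩
      · rw [SimpleGraph.edist_comm, ← Nat.succ_injective hp]
        exact SimpleGraph.edist_le p
      · exact (htri hyv.symm).trans (Order.add_one_le_of_lt hlt)
  · rintro (h | ⟨v, hv, hvy⟩)
    · exact h.trans (by exact_mod_cast k.le_succ)
    · exact (htri hvy).trans_eq (by rw [hv, Nat.cast_succ])

section Search

variable {V : Type}

/-- The state of a breadth-first search from `u` that has reached depth `k`: `layer` enumerates
the sphere and `seen` is the closed ball of radius `k` around `u`. -/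
structure IsBFSLayer (H : SimpleGraph V) (u : V) (k : ℕ) (layer : List V) (seen : Finset V) :
    Prop where
  mem_layer : ∀ x, x ∈ layer ↔ H.edist u x = k
  mem_seen : ∀ x, x ∈ seen ↔ H.edist u x ≤ k
  nodup : layer.Nodup

lemma IsBFSLayer.zero (H : SimpleGraph V) (u : V) : IsBFSLayer H u 0 [u] {u} where
  mem_layer x := by simpa using eq_comm
  mem_seen x := by simpa using eq_comm
  nodup := List.nodup_singleton u

lemma IsBFSLayer.ncard_ball_succ [Finite V] {H : SimpleGraph V} {u : V} {k : ℕ} {layer : List V}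
    {seen : Finset V} (h : IsBFSLayer H u k layer seen) :
    (H.ball u (k + 1 : ℕ)).ncard = (H.ball u k).ncard + layer.length := by
  classical
  have hball : H.ball u (k + 1 : ℕ) = H.ball u k ∪ layer.toFinset := by
    ext x
    simp only [Set.mem_union, SimpleGraph.mem_ball, Finset.mem_coe, List.mem_toFinset, h.mem_layer,
      H.edist_comm (u := x), ← le_iff_lt_or_eq, Nat.cast_succ,
      ENat.lt_add_one_iff (ENat.natCast_ne_top k)]
  rw [hball, Set.ncard_union_eq, Set.ncard_coe_finset, List.toFinset_card_of_nodup h.nodup]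
  rw [Set.disjoint_left]
  intro x hx hxl
  rw [SimpleGraph.mem_ball, SimpleGraph.edist_comm] at hx
  exact hx.ne ((h.mem_layer x).1 (by simpa using hxl))

variable [DecidableEq V]

lemma scan_time (l : List V) (seen : Finset V) (next : List V) :
    (scan l seen next).time = 1 + 3 * l.length := by
  induction l generalizing seen next with
  | nil => simp [scan]
  | cons w l ih =>
    simp only [scan, Timed.bind_time, tick_time, List.length_cons]
    split_ifs <;> rw [ih] <;> ring

lemma scan_append_val (l₁ l₂ : List V) (seen : Finset V) (next : List V) :
    (scan (l₁ ++ l₂) seen next).val =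
      (scan l₂ (scan l₁ seen next).val.1 (scan l₁ seen next).val.2).val := by
  induction l₁ generalizing seen next with
  | nil => simp [scan]
  | cons w l ih =>
    simp only [List.cons_append, scan, Timed.bind_val]
    split_ifs <;> exact ih _ _

lemma mem_scan_fst {l : List V} {seen : Finset V} {next : List V} {x : V} :
    x ∈ (scan l seen next).val.1 ↔ x ∈ seen ∨ x ∈ l := by
  induction l generalizing seen next with
  | nil => simp [scan]
  | cons w l ih =>
    simp only [scan, Timed.bind_val, List.mem_cons]
    split_ifs <;> grind

lemma mem_scan_snd {l : List V} {seen : Finset V} {next : List V} {x : V} :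
    x ∈ (scan l seen next).val.2 ↔ x ∈ next ∨ x ∉ seen ∧ x ∈ l := by
  induction l generalizing seen next with
  | nil => simp [scan]
  | cons w l ih =>
    simp only [scan, Timed.bind_val, List.mem_cons]
    split_ifs <;> grind

lemma nodup_scan {l : List V} {seen : Finset V} {next : List V} (hnext : next.Nodup)
    (hseen : ∀ x ∈ next, x ∈ seen) : (scan l seen next).val.2.Nodup := by
  induction l generalizing seen next with
  | nil => simpa [scan]
  | cons w l ih =>
    simp only [scan, Timed.bind_val]
    split_ifs <;> grind

lemma expand_val (adj : V → List V) (l : List V) (seen : Finset V) (next : List V) :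
    (expand adj l seen next).val = (scan (l.flatMap adj) seen next).val := by
  induction l generalizing seen next with
  | nil => simp [expand, scan]
  | cons v l ih =>
    simp only [expand, Timed.bind_val, List.flatMap_cons, scan_append_val, ih]

lemma expand_time_le {adj : V → List V} {d : ℕ} (hd : ∀ v, (adj v).length ≤ d) (l : List V)
    (seen : Finset V) (next : List V) :
    (expand adj l seen next).time ≤ 1 + (2 + 3 * d) * l.length := by
  induction l generalizing seen next with
  | nil => simp [expand]
  | cons v l ih =>
    simp only [expand, Timed.bind_time, tick_time, List.length_cons, scan_time]
    linarith [ih (scan (adj v) seen next).val.1 (scan (adj v) seen next).val.2, hd v]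

lemma paint_time (l : List V) (white painted : Finset V) :
    (paint l white painted).time = 1 + 3 * l.length := by
  induction l generalizing white painted with
  | nil => simp [paint]
  | cons w l ih =>
    simp only [paint, Timed.bind_time, tick_time, List.length_cons]
    split_ifs <;> rw [ih] <;> ring

lemma paint_val (l : List V) (white painted : Finset V) :
    (paint l white painted).val = (white \ l.toFinset, painted ∪ white ∩ l.toFinset) := by
  induction l generalizing white painted with
  | nil => simp [paint]
  | cons w l ih =>
    simp only [paint, Timed.bind_val]
    split_ifs <;> rw [ih] <;> ext x <;> grind [List.mem_toFinset]

/-- The function `adj` lists the neighbours of every vertex of `H`, possibly with repetitions: the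
form in which the searches receive a graph. -/
def IsAdjList (H : SimpleGraph V) (adj : V → List V) : Prop :=
  ∀ v x, x ∈ adj v ↔ H.Adj v x

variable {H : SimpleGraph V} {adj : V → List V}

lemma mem_expand_fst (hadj : IsAdjList H adj) {l : List V} {seen : Finset V} {x : V} :
    x ∈ (expand adj l seen []).val.1 ↔ x ∈ seen ∨ ∃ v ∈ l, H.Adj v x := by
  simp only [expand_val, mem_scan_fst, List.mem_flatMap, hadj _ _]

lemma mem_expand_snd (hadj : IsAdjList H adj) {l : List V} {seen : Finset V} {x : V} :
    x ∈ (expand adj l seen []).val.2 ↔ x ∉ seen ∧ ∃ v ∈ l, H.Adj v x := by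
  simp only [expand_val, mem_scan_snd, List.mem_flatMap, hadj _ _, List.not_mem_nil, false_or]

lemma nodup_expand (l : List V) (seen : Finset V) : (expand adj l seen []).val.2.Nodup := by
  rw [expand_val]
  exact nodup_scan List.nodup_nil (by simp)

namespace IsBFSLayer

variable {u : V} {k : ℕ} {layer : List V} {seen : Finset V}

lemma succ (h : IsBFSLayer H u k layer seen) (hadj : IsAdjList H adj) :
    IsBFSLayer H u (k + 1) (expand adj layer seen []).val.2 (expand adj layer seen []).val.1 where
  mem_layer x := by
    have hlt : H.edist u x = (k + 1 : ℕ) ↔ ¬ H.edist u x ≤ k ∧ H.edist u x ≤ (k + 1 : ℕ) := by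
      rw [not_le, Nat.cast_succ, ← Order.add_one_le_iff_of_not_isMax (by simp), le_antisymm_iff,
        and_comm]
    simp only [mem_expand_snd hadj, h.mem_seen, h.mem_layer, hlt, edist_le_succ_iff (k := k)]
    tauto
  mem_seen x := by
    simp only [mem_expand_fst hadj, h.mem_seen, h.mem_layer, edist_le_succ_iff (k := k)]
  nodup := nodup_expand layer seen

lemma paint_val_fst (h : IsBFSLayer H u k layer seen) {white : Finset V}
    (hwhite : ∀ x ∈ white, (k : ℕ∞) ≤ H.edist u x) (painted : Finset V) :
    (paint layer white painted).val.1 = outerPart H white u k := by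
  ext x
  simp only [paint_val, Finset.mem_sdiff, List.mem_toFinset, h.mem_layer, mem_outerPart]
  exact and_congr_right fun hx => ⟨fun hne => (hwhite x hx).lt_of_ne' hne, ne_of_gt⟩

lemma paint_val_snd (h : IsBFSLayer H u k layer seen) (white painted : Finset V) :
    (paint layer white painted).val.2 = painted ∪ spherePart H white u k := by
  ext x
  simp [paint_val, h.mem_layer]

end IsBFSLayer

lemma sweep_val {u : V} {k : ℕ} {layer : List V} {seen white : Finset V}
    (h : IsBFSLayer H u k layer seen) (hadj : IsAdjList H adj)
    (hwhite : ∀ x ∈ white, (k : ℕ∞) ≤ H.edist u x) (q : ℕ) (blue red : Finset V) :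
    (sweep adj q layer seen white blue red).val.1 = outerPart H white u (k + q) ∧
      (sweep adj q layer seen white blue red).val.2.1 =
        blue ∪ spherePart H white u (k + q) := by
  induction q generalizing k layer seen white blue red with
  | zero => exact ⟨h.paint_val_fst hwhite blue, h.paint_val_snd white blue⟩
  | succ q ih =>
    have hpaint := h.paint_val_fst hwhite red
    have hnext := ih (h.succ hadj) (white := (paint layer white red).val.1) (fun x hx => by
      rw [hpaint, mem_outerPart] at hx
      exact_mod_cast Order.add_one_le_of_lt hx.2) blue (paint layer white red).val.2
    rw [hpaint, outerPart_outerPart (by omega), spherePart_outerPart (by omega),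
      show k + 1 + q = k + (q + 1) by ring] at hnext
    rw [← hpaint] at hnext
    exact hnext

lemma sweep_time_le [Finite V] {u : V} {k d : ℕ} {layer : List V} {seen : Finset V}
    (h : IsBFSLayer H u k layer seen) (hadj : IsAdjList H adj) (hd : ∀ v, (adj v).length ≤ d)
    (q : ℕ) (white blue red : Finset V) :
    (sweep adj q layer seen white blue red).time + (5 + 3 * d) * (H.ball u k).ncard ≤
      3 * (q + 1) + (5 + 3 * d) * (H.ball u (k + q + 1 : ℕ)).ncard := by
  induction q generalizing k layer seen white blue red with
  | zero =>
    simp only [sweep, Timed.bind_time, Timed.pure_time, paint_time, tick_time, add_zero,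
      h.ncard_ball_succ]
    linarith [Nat.zero_le ((2 + 3 * d) * layer.length)]
  | succ q ih =>
    have hnext := ih (h.succ hadj) (paint layer white red).val.1 blue (paint layer white red).val.2
    rw [h.ncard_ball_succ, show k + 1 + q + 1 = k + (q + 1) + 1 by ring] at hnext
    simp only [sweep, Timed.bind_time, paint_time, tick_time]
    linarith [expand_time_le hd layer seen []]

end Search

section DecompositionLoop

lemma bind_congr_of_mem_support {α β : Type*} {p : PMF α} {f g : α → PMF β}
    (h : ∀ a ∈ p.support, f a = g a) : p.bind f = p.bind g := by
  rw [← PMF.bindOnSupport_eq_bind, ← PMF.bindOnSupport_eq_bind]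
  congr 1
  exact funext₂ h

variable {V : Type} [DecidableEq V] {H : SimpleGraph V} {adj : V → List V}

lemma dbDimRun_map_val (hadj : IsAdjList H adj) (Q : PMF ℕ) (K : ℕ) {k : ℕ} {white : Finset V}
    (hk : white.card ≤ k) (blue red : Finset V) :
    (dbDimRun adj Q K k white blue red).map Timed.val = dbDimFrom H Q white blue := by
  induction k generalizing white blue red with
  | zero =>
    obtain rfl : white = ∅ := by simpa using hk
    simp [dbDimRun, PMF.pure_map]
  | succ k ih =>
    rw [dbDimRun]
    split_ifs with hwhite
    · rw [dbDimFrom_of_nonempty H Q hwhite, PMF.map_bind]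
      refine bind_congr_of_mem_support fun u hu => ?_
      rw [PMF.map_bind]
      congr 1 with q : 1
      obtain ⟨hout, hblue⟩ := sweep_val (.zero H u) hadj (by simp) q blue red (white := white)
      rw [zero_add] at hout hblue
      have hcard : (sweep adj q [u] {u} white blue red).val.1.card ≤ k := by
        have := card_outerPart_lt H ((PMF.mem_support_uniformOfFinset_iff hwhite u).1 hu) q
        rw [hout]
        omega
      simp only [map_val_andThen, PMF.pure_map, PMF.pure_bind, Timed.bind_val, ih hcard]
      rw [hout, hblue]
      congr!
    · obtain rfl := Finset.not_nonempty_iff_eq_empty.1 hwhite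
      simp [PMF.pure_map]

lemma dbDimRun_time_le [Finite V] (hadj : IsAdjList H adj) {d : ℕ}
    (hd : ∀ v, (adj v).length ≤ d) {Q : PMF ℕ} {K A : ℕ} (hQ : ∀ q ∈ Q.support, q ≤ K)
    (hA : ∀ u, (H.ball u (K + 1 : ℕ)).ncard ≤ A) {k : ℕ} {white blue red : Finset V}
    {r : Timed (Finset V)} (hr : r ∈ (dbDimRun adj Q K k white blue red).support) :
    r.time ≤ 1 + k * (4 * K + 7 + (5 + 3 * d) * A) := by
  induction k generalizing white blue red r with
  | zero =>
    obtain rfl := (PMF.mem_support_pure_iff _ _).1 hr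
    simp
  | succ k ih =>
    rw [dbDimRun] at hr
    split_ifs at hr with hwhite
    · simp only [PMF.mem_support_bind_iff, mem_support_andThen, PMF.mem_support_pure_iff,
        exists_eq_left] at hr
      obtain ⟨u, -, q, hq, r, hr, rfl⟩ := hr
      have hball : (H.ball u (0 + q + 1 : ℕ)).ncard ≤ A :=
        (Set.ncard_le_ncard (SimpleGraph.ball_mono (by simpa using hQ q hq))).trans (hA u)
      have hsweep := sweep_time_le (.zero H u) hadj hd q white blue red
      rw [Nat.cast_zero, SimpleGraph.ball_zero, Set.ncard_empty, mul_zero, add_zero] at hsweep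
      simp only [Timed.bind_time, tick_time]
      linarith [ih hr, hQ q hq, Nat.mul_le_mul_left (5 + 3 * d) hball]
    · obtain rfl := (PMF.mem_support_pure_iff _ _).1 hr
      simp

end DecompositionLoop

section Explore

variable {V : Type}

/-- A state of the exploration of the component of `v`, started with `seen₀` marked as seen: the
current breadth-first layer, the marked vertices, and the vertices of the earlier layers. -/
structure IsExploreState (G : SimpleGraph V) (seen₀ : Finset V) (v : V) (layer : List V)
    (seen : Finset V) (acc : List V) : Prop where
  mem_seen : ∀ x, x ∈ seen ↔ x ∈ seen₀ ∨ x ∈ layer ++ acc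
  nodup : (layer ++ acc).Nodup
  notMem : ∀ x ∈ layer ++ acc, x ∉ seen₀
  reachable : ∀ x ∈ layer ++ acc, G.Reachable v x
  start : v ∈ layer ++ acc
  closed : ∀ x ∈ acc, ∀ y, G.Adj x y → y ∈ seen

namespace IsExploreState

variable {G : SimpleGraph V} {adj : V → List V} {seen₀ seen : Finset V} {v : V} {layer acc : List V}

lemma mem_iff_reachable (h : IsExploreState G seen₀ v [] seen acc)
    (hclosed : ∀ x ∈ seen₀, ∀ y, G.Adj x y → y ∈ seen₀) {x : V} : x ∈ acc ↔ G.Reachable v x := by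
  refine ⟨h.reachable x, fun hx => ?_⟩
  rw [SimpleGraph.reachable_iff_reflTransGen] at hx
  induction hx with
  | refl => exact h.start
  | @tail y z _ hyz ih =>
    exact ((h.mem_seen z).1 (h.closed y ih z hyz)).resolve_left fun hz =>
      h.notMem y ih (hclosed z hz y hyz.symm)

variable [DecidableEq V]

lemma init (G : SimpleGraph V) (hv : v ∉ seen₀) :
    IsExploreState G seen₀ v [v] (insert v seen₀) [] where
  mem_seen x := by simp [or_comm]
  nodup := by simp
  notMem := by simpa
  reachable := by simp
  start := by simp
  closed := by simp

lemma expand (h : IsExploreState G seen₀ v layer seen acc) (hadj : IsAdjList G adj) :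
    IsExploreState G seen₀ v (expand adj layer seen []).val.2 (expand adj layer seen []).val.1
      (layer ++ acc) where
  mem_seen x := by
    simp only [List.mem_append, mem_expand_fst hadj, mem_expand_snd hadj, h.mem_seen]
    grind
  nodup := (nodup_expand layer seen).append h.nodup fun x hx hx' =>
    ((mem_expand_snd hadj).1 hx).1 ((h.mem_seen x).2 (Or.inr hx'))
  notMem x hx := by
    rcases List.mem_append.1 hx with hx | hx
    · exact fun hx₀ => ((mem_expand_snd hadj).1 hx).1 ((h.mem_seen x).2 (Or.inl hx₀))
    · exact h.notMem x hx
  reachable x hx := by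
    rcases List.mem_append.1 hx with hx | hx
    · obtain ⟨w, hw, hwx⟩ := ((mem_expand_snd hadj).1 hx).2
      exact (h.reachable w (List.mem_append_left _ hw)).trans hwx.reachable
    · exact h.reachable x hx
  start := List.mem_append_right _ h.start
  closed x hx y hxy := by
    refine (mem_expand_fst hadj).2 ?_
    rcases List.mem_append.1 hx with hx | hx
    · exact Or.inr ⟨x, hx, hxy⟩
    · exact Or.inl (h.closed x hx y hxy)

lemma explore [Fintype V] (h : IsExploreState G seen₀ v layer seen acc) (hadj : IsAdjList G adj)
    {k : ℕ} (hk : Fintype.card V ≤ k + acc.length) :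
    IsExploreState G seen₀ v [] (explore adj k layer seen acc).val.1
      (explore adj k layer seen acc).val.2 := by
  induction k generalizing layer seen acc with
  | zero =>
    obtain rfl : layer = [] := by
      have := h.nodup.length_le_card
      rw [List.length_append] at this
      exact List.length_eq_zero_iff.1 (by omega)
    exact h
  | succ k ih =>
    match layer with
    | [] => exact h
    | w :: l =>
      refine ih (h.expand hadj) ?_
      simp only [List.length_append, List.length_cons]
      omega

end IsExploreState

lemma explore_time_le [DecidableEq V] {adj : V → List V} {d : ℕ} (hd : ∀ v, (adj v).length ≤ d)
    (k : ℕ) (layer : List V) (seen : Finset V) (acc : List V) :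
    (explore adj k layer seen acc).time + (5 + 3 * d) * acc.length ≤
      1 + (5 + 3 * d) * (explore adj k layer seen acc).val.2.length := by
  induction k generalizing layer seen acc with
  | zero => exact le_rfl
  | succ k ih =>
    match layer with
    | [] => exact le_rfl
    | w :: l =>
      simp only [explore, Timed.bind_time, Timed.bind_val, tick_time]
      have hexpand := expand_time_le hd (w :: l) seen []
      have hrec := ih (expand adj (w :: l) seen []).val.2 (expand adj (w :: l) seen []).val.1
        (w :: l ++ acc)
      simp only [List.length_append, List.length_cons] at hrec hexpand
      linarith

end Explore

namespace MRF

variable {n : ℕ} {S : Type} (M : MRF n S)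

section Tables

lemma mk_lo_hi (e : M.Edge) : s(M.lo e, M.hi e) = e.1 := by
  unfold lo hi
  induction e.1 using Sym2.ind with
  | _ a b =>
    rcases le_total a b with h | h
    · simp [h]
    · simp [h, Sym2.eq_swap]

lemma mem_edge_iff {e : M.Edge} {v : Fin n} : v ∈ e.1 ↔ v = M.lo e ∨ v = M.hi e := by
  rw [← M.mk_lo_hi e, Sym2.mem_iff]

lemma lo_ne_hi (e : M.Edge) : M.lo e ≠ M.hi e := by
  have hadj : M.graph.Adj (M.lo e) (M.hi e) := by
    rw [← SimpleGraph.mem_edgeSet, M.mk_lo_hi]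
    exact e.2
  exact hadj.ne

lemma cutGraph_adj {B : Finset M.Edge} {u v : Fin n} :
    (M.cutGraph B).Adj u v ↔ ∃ e : M.Edge, e ∉ B ∧ e.1 = s(u, v) := by
  rw [cutGraph, SimpleGraph.deleteEdges_adj]
  constructor
  · rintro ⟨h, hB⟩
    exact ⟨⟨s(u, v), h⟩, fun hmem => hB ⟨_, hmem, rfl⟩, rfl⟩
  · rintro ⟨e, he, heq⟩
    refine ⟨by simpa only [SimpleGraph.mem_edgeSet, heq] using e.2, ?_⟩
    rintro ⟨f, hf, hfe⟩
    exact he (Subtype.ext (hfe.trans heq.symm) ▸ hf)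

lemma cutGraph_adj_lo_hi {B : Finset M.Edge} {e : M.Edge} (he : e ∉ B) :
    (M.cutGraph B).Adj (M.lo e) (M.hi e) :=
  M.cutGraph_adj.2 ⟨e, he, (M.mk_lo_hi e).symm⟩

lemma mem_inc {v : Fin n} {e : M.Edge} : e ∈ M.inc v ↔ v ∈ e.1 := by
  simp [inc]

lemma nodup_inc (v : Fin n) : (M.inc v).Nodup := Finset.nodup_toList _

lemma length_inc_le (v : Fin n) : (M.inc v).length ≤ doublingConstant M.graph := by
  refine le_of_eq_of_le ?_ (ncard_edgesAt_le M.graph v)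
  rw [inc, Finset.length_toList, ← Set.ncard_coe_finset]
  simp

lemma copyOthers_val (e : M.Edge) (l acc : List M.Edge) :
    (M.copyOthers e l acc).val = (l.filter (· ≠ e)).reverse ++ acc := by
  induction l generalizing acc with
  | nil => simp [copyOthers]
  | cons f l ih =>
    simp only [copyOthers, Timed.bind_val]
    split_ifs with h <;> simp [ih, h]

lemma copyOthers_time (e : M.Edge) (l acc : List M.Edge) :
    (M.copyOthers e l acc).time = 1 + 2 * l.length := by
  induction l generalizing acc with
  | nil => simp [copyOthers]
  | cons f l ih =>
    simp only [copyOthers, Timed.bind_time, tick_time, List.length_cons]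
    split_ifs <;> rw [ih] <;> ring

/-- The neighbours of an edge in the graph of edges, in the order in which `edgeAdj` lists them. -/
noncomputable def neighborEdges (e : M.Edge) : List M.Edge :=
  (M.copyOthers e (M.inc (M.hi e)) (M.copyOthers e (M.inc (M.lo e)) []).val).val

lemma isAdjList_neighborEdges : IsAdjList M.graph.lineGraph M.neighborEdges := by
  intro e f
  rw [neighborEdges, copyOthers_val, copyOthers_val, SimpleGraph.lineGraph_adj_iff_exists]
  simp only [List.mem_append, List.mem_reverse, List.mem_filter, decide_eq_true_eq, mem_inc,
    List.not_mem_nil, or_false, M.mem_edge_iff (e := e), or_and_right, exists_or, exists_eq_left]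
  tauto

lemma length_neighborEdges_le (e : M.Edge) :
    (M.neighborEdges e).length ≤ 2 * doublingConstant M.graph := by
  simp only [neighborEdges, copyOthers_val, List.append_nil, List.length_append,
    List.length_reverse]
  have hlo := (List.length_filter_le (· ≠ e) _).trans (M.length_inc_le (M.lo e))
  have hhi := (List.length_filter_le (· ≠ e) _).trans (M.length_inc_le (M.hi e))
  omega

lemma edgeAdj_val {l : List M.Edge} {tab : M.Edge → List M.Edge}
    (h : ∀ e, e ∉ l → tab e = M.neighborEdges e) : (M.edgeAdj l tab).val = M.neighborEdges := by
  induction l generalizing tab with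
  | nil => exact funext fun e => h e List.not_mem_nil
  | cons e l ih =>
    refine ih fun f hf => ?_
    rcases eq_or_ne f e with rfl | hfe
    · exact Function.update_self ..
    · exact (Function.update_of_ne hfe ..).trans (h f (by simp [hfe, hf]))

lemma edgeAdj_time_le (l : List M.Edge) (tab : M.Edge → List M.Edge) :
    (M.edgeAdj l tab).time ≤ 1 + l.length * (4 + 4 * doublingConstant M.graph) := by
  induction l generalizing tab with
  | nil => simp [edgeAdj]
  | cons e l ih =>
    simp only [edgeAdj, Timed.bind_time, tick_time, List.length_cons, copyOthers_time]
    have hrest := ih (Function.update tab e (M.neighborEdges e))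
    rw [neighborEdges] at hrest
    linarith [M.length_inc_le (M.lo e), M.length_inc_le (M.hi e)]

lemma decompRun_map_val (p : ℝ) (hp : p ∈ Set.Icc (0 : ℝ) 1) (K : ℕ) :
    (M.decompRun p hp K).map Timed.val = dbDim M.graph.lineGraph p hp K := by
  rw [decompRun, map_val_andThen, PMF.pure_map, PMF.pure_bind, Timed.bind_val,
    M.edgeAdj_val (by simp)]
  exact dbDimRun_map_val M.isAdjList_neighborEdges _ _ (by simp) _ _

lemma decompRun_time_le {p : ℝ} {hp : p ∈ Set.Icc (0 : ℝ) 1} {K : ℕ} {r : Timed (Finset M.Edge)}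
    (hr : r ∈ (M.decompRun p hp K).support) :
    r.time ≤ 3 + Fintype.card M.Edge * (4 * K + 14 + 4 * doublingConstant M.graph +
      (5 + 6 * doublingConstant M.graph) * doublingConstant M.graph ^ (Nat.log 2 K + 2)) := by
  rw [decompRun, mem_support_andThen] at hr
  simp only [PMF.mem_support_pure_iff, exists_eq_left, Timed.bind_val, Timed.bind_time,
    tick_time] at hr
  obtain ⟨s, hs, rfl⟩ := hr
  rw [M.edgeAdj_val (by simp)] at hs
  have hloop := dbDimRun_time_le M.isAdjList_neighborEdges M.length_neighborEdges_le
    (fun q hq => le_of_mem_support_stopLaw hp hq) (ncard_lineGraph_ball_succ_le M.graph · K) hs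
  have htable := M.edgeAdj_time_le Finset.univ.toList fun _ => []
  rw [Finset.length_toList, Finset.card_univ] at htable
  linarith

lemma keepRow_val (B : Finset M.Edge) (v : Fin n) (l : List M.Edge) (nb : List (Fin n))
    (low : List M.Edge) : (M.keepRow B v l nb low).val =
      (((l.filter (· ∉ B)).map fun e => if M.lo e = v then M.hi e else M.lo e).reverse ++ nb,
        (l.filter fun e => e ∉ B ∧ M.lo e = v).reverse ++ low) := by
  induction l generalizing nb low with
  | nil => simp [keepRow]
  | cons e l ih =>
    simp only [keepRow, Timed.bind_val]
    split_ifs with hB hlo <;> simp [*]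

lemma keepRow_time (B : Finset M.Edge) (v : Fin n) (l : List M.Edge) (nb : List (Fin n))
    (low : List M.Edge) : (M.keepRow B v l nb low).time = 1 + 4 * l.length := by
  induction l generalizing nb low with
  | nil => simp [keepRow]
  | cons e l ih =>
    simp only [keepRow, Timed.bind_time, tick_time, List.length_cons]
    split_ifs <;> rw [ih] <;> ring

/-- The neighbours of a vertex and the edges of which it is the smaller endpoint, in the graph
without the removed edges, in the order in which `keepTable` lists them. -/
noncomputable def keptAt (B : Finset M.Edge) (v : Fin n) : List (Fin n) × List M.Edge :=
  (M.keepRow B v (M.inc v) [] []).val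

lemma keepTable_val {B : Finset M.Edge} {l : List (Fin n)}
    {tab : Fin n → List (Fin n) × List M.Edge} (h : ∀ v, v ∉ l → tab v = M.keptAt B v) :
    (M.keepTable B l tab).val = M.keptAt B := by
  induction l generalizing tab with
  | nil => exact funext fun v => h v List.not_mem_nil
  | cons v l ih =>
    refine ih fun w hw => ?_
    rcases eq_or_ne w v with rfl | hwv
    · exact Function.update_self ..
    · exact (Function.update_of_ne hwv ..).trans (h w (by simp [hwv, hw]))

lemma keepTable_time_le (B : Finset M.Edge) (l : List (Fin n))
    (tab : Fin n → List (Fin n) × List M.Edge) :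
    (M.keepTable B l tab).time ≤ 1 + l.length * (3 + 4 * doublingConstant M.graph) := by
  induction l generalizing tab with
  | nil => simp [keepTable]
  | cons v l ih =>
    simp only [keepTable, Timed.bind_time, tick_time, List.length_cons, keepRow_time]
    have hrest := ih (Function.update tab v (M.keptAt B v))
    rw [keptAt] at hrest
    linarith [M.length_inc_le v]

lemma isAdjList_keptAt (B : Finset M.Edge) :
    IsAdjList (M.cutGraph B) fun v => (M.keptAt B v).1 := by
  intro v x
  simp only [keptAt, keepRow_val, List.append_nil, List.mem_reverse, List.mem_map, List.mem_filter,
    decide_eq_true_eq, mem_inc, cutGraph_adj, mem_edge_iff]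
  refine exists_congr fun e => ?_
  rw [← M.mk_lo_hi e, Sym2.eq_iff]
  have hne := M.lo_ne_hi e
  split_ifs <;> grind

lemma length_keptAt_fst_le (B : Finset M.Edge) (v : Fin n) :
    (M.keptAt B v).1.length ≤ doublingConstant M.graph := by
  simp only [keptAt, keepRow_val, List.append_nil, List.length_reverse, List.length_map]
  exact (List.length_filter_le _ _).trans (M.length_inc_le v)

lemma mem_keptAt_snd {B : Finset M.Edge} {v : Fin n} {e : M.Edge} :
    e ∈ (M.keptAt B v).2 ↔ e ∉ B ∧ M.lo e = v := by
  simp only [keptAt, keepRow_val, List.append_nil, List.mem_reverse, List.mem_filter, mem_inc,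
    decide_eq_true_eq, mem_edge_iff, and_iff_right_iff_imp]
  exact fun h => Or.inl h.2.symm

lemma nodup_keptAt_snd (B : Finset M.Edge) (v : Fin n) : (M.keptAt B v).2.Nodup := by
  simpa only [keptAt, keepRow_val, List.append_nil, List.nodup_reverse]
    using (M.nodup_inc v).filter _

lemma length_keptAt_snd_le (B : Finset M.Edge) (v : Fin n) :
    (M.keptAt B v).2.length ≤ doublingConstant M.graph := by
  simp only [keptAt, keepRow_val, List.append_nil, List.length_reverse]
  exact (List.length_filter_le _ _).trans (M.length_inc_le v)

end Tables

end MRF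

namespace Timed

variable {α β : Type}

lemma foldlM_val (f : β → α → Timed β) (l : List α) (b : β) :
    (l.foldlM f b).val = l.foldl (fun b a => (f b a).val) b := by
  induction l generalizing b with
  | nil => rfl
  | cons a l ih => rw [List.foldlM_cons, bind_val, ih, List.foldl_cons]

lemma foldlM_time_le {f : β → α → Timed β} {t : ℕ} (hf : ∀ b a, (f b a).time ≤ t) (l : List α)
    (b : β) : (l.foldlM f b).time ≤ l.length * t := by
  induction l generalizing b with
  | nil => simp
  | cons a l ih =>
    rw [List.foldlM_cons, bind_time, List.length_cons]
    linarith [hf b a, ih (f b a).val]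

end Timed

lemma le_foldl_of_mem {α β γ : Type*} [Preorder γ] {f : β → α → β} {g : β → γ} {c : γ}
    (hmono : ∀ b a, g b ≤ g (f b a)) {l : List α} {a : α} (ha : a ∈ l)
    (hc : ∀ b, c ≤ g (f b a)) (b : β) : c ≤ g (l.foldl f b) := by
  obtain ⟨l₁, l₂, rfl⟩ := List.append_of_mem ha
  rw [List.foldl_append, List.foldl_cons]
  exact List.foldlRecOn (motive := fun b => c ≤ g b) l₂ f (hc _) fun b hb a _ =>
    hb.trans (hmono b a)

namespace MRF

variable {n : ℕ} {S : Type} (M : MRF n S)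

section Score

variable (low : Fin n → List M.Edge)

lemma edgeScore_val (x : Fin n → S) (l : List M.Edge) (acc : ℝ) :
    (M.edgeScore x l acc).val =
      acc + (l.map fun e => M.edgePot e (x (M.lo e)) (x (M.hi e))).sum := by
  induction l generalizing acc with
  | nil => simp [edgeScore]
  | cons e l ih =>
    simp only [edgeScore, Timed.bind_val, List.map_cons, List.sum_cons, ih, add_assoc]

lemma edgeScore_time (x : Fin n → S) (l : List M.Edge) (acc : ℝ) :
    (M.edgeScore x l acc).time = 1 + 2 * l.length := by
  induction l generalizing acc with
  | nil => simp [edgeScore]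
  | cons e l ih =>
    simp only [edgeScore, Timed.bind_time, tick_time, List.length_cons, ih]
    ring

lemma score_val (x : Fin n → S) (l : List (Fin n)) (acc : ℝ) :
    (M.score low x l acc).val = acc + (l.map fun v => M.nodePot v (x v) +
      ((low v).map fun e => M.edgePot e (x (M.lo e)) (x (M.hi e))).sum).sum := by
  induction l generalizing acc with
  | nil => simp [score]
  | cons v l ih =>
    simp only [score, Timed.bind_val, List.map_cons, List.sum_cons, ih, edgeScore_val]
    ring

variable {low} in
lemma score_time_le {d : ℕ} (hd : ∀ v, (low v).length ≤ d) (x : Fin n → S) (l : List (Fin n))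
    (acc : ℝ) : (M.score low x l acc).time ≤ 1 + l.length * (3 + 2 * d) := by
  induction l generalizing acc with
  | nil => simp [score]
  | cons v l ih =>
    simp only [score, Timed.bind_time, tick_time, List.length_cons, edgeScore_time]
    linarith [ih (M.edgeScore x (low v) (acc + M.nodePot v (x v))).val, hd v]

lemma score_keptAt {B : Finset M.Edge} {c : (M.cutGraph B).ConnectedComponent}
    {comp : List (Fin n)} (hnodup : comp.Nodup) (hcomp : ∀ w, w ∈ comp ↔ w ∈ c.supp)
    (x : Fin n → S) :
    (M.score (fun w => (M.keptAt B w).2) x comp 0).val = M.energyOn B c x := by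
  classical
  have hvert : comp.toFinset = ({v | (M.cutGraph B).connectedComponentMk v = c} : Finset _) := by
    ext w
    simp [hcomp]
  rw [score_val, zero_add, energyOn, ← List.sum_toFinset _ hnodup, Finset.sum_add_distrib, hvert]
  congr 1
  rw [← Finset.sum_fiberwise_of_maps_to (g := M.lo)
    (t := {v | (M.cutGraph B).connectedComponentMk v = c}) (by simp)]
  refine Finset.sum_congr rfl fun v hv => ?_
  rw [← List.sum_toFinset _ (M.nodup_keptAt_snd B v)]
  refine Finset.sum_congr ?_ fun _ _ => rfl
  ext e
  simp only [Finset.mem_filter, Finset.mem_univ, true_and, List.mem_toFinset,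
    mem_keptAt_snd] at hv ⊢
  constructor
  · rintro ⟨he, rfl⟩
    exact ⟨⟨he, hv⟩, rfl⟩
  · exact fun ⟨⟨he, _⟩, hlo⟩ => ⟨he, hlo⟩

lemma energyOn_congr {B : Finset M.Edge} {c : (M.cutGraph B).ConnectedComponent}
    {x y : Fin n → S} (h : ∀ w ∈ c.supp, x w = y w) : M.energyOn B c x = M.energyOn B c y := by
  unfold energyOn
  congr 1
  · refine Finset.sum_congr rfl fun v hv => ?_
    rw [h v (by simpa using hv)]
  · refine Finset.sum_congr rfl fun e he => ?_
    obtain ⟨heB, hlo⟩ : e ∉ B ∧ M.lo e ∈ c.supp := by simpa using he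
    have hhi : M.hi e ∈ c.supp :=
      c.mem_supp_of_adj_mem_supp hlo (M.cutGraph_adj_lo_hi heB)
    rw [h _ hlo, h _ hhi]

end Score

section Exhaust

variable {letters : List S} {low : Fin n → List M.Edge} {comp : List (Fin n)}

lemma exhaust_cons_val (letters : List S) (low : Fin n → List M.Edge) (comp : List (Fin n))
    (v : Fin n) (l : List (Fin n)) (x : Fin n → S) (best : ℝ × (Fin n → S)) :
    (M.exhaust letters low comp (v :: l) x best).val = letters.foldl
      (fun b a => (M.exhaust letters low comp l (Function.update x v a) b).val) best := by
  simp only [exhaust, Timed.bind_val, Timed.foldlM_val]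

lemma exhaust_val_eq_or (letters : List S) (low : Fin n → List M.Edge) (comp : List (Fin n))
    (l : List (Fin n)) (x : Fin n → S) (best : ℝ × (Fin n → S)) :
    (M.exhaust letters low comp l x best).val = best ∨ ∃ y, (∀ w, w ∉ l → y w = x w) ∧
      (M.exhaust letters low comp l x best).val = ((M.score low y comp 0).val, y) := by
  induction l generalizing x best with
  | nil =>
    simp only [exhaust, Timed.bind_val]
    split_ifs
    · exact Or.inr ⟨x, fun _ _ => rfl, rfl⟩
    · exact Or.inl rfl
  | cons v l ih =>
    rw [exhaust_cons_val]
    refine List.foldlRecOn (motive := fun b => b = best ∨ ∃ y, (∀ w, w ∉ v :: l → y w = x w) ∧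
      b = ((M.score low y comp 0).val, y)) letters _ (Or.inl rfl) fun b hb a _ => ?_
    rcases ih (Function.update x v a) b with h | ⟨y, hy, h⟩
    · rwa [h]
    · refine Or.inr ⟨y, fun w hw => ?_, h⟩
      rw [List.mem_cons, not_or] at hw
      rw [hy w hw.2, Function.update_of_ne hw.1]

lemma le_exhaust_val (letters : List S) (low : Fin n → List M.Edge) (comp : List (Fin n))
    (l : List (Fin n)) (x : Fin n → S) (best : ℝ × (Fin n → S)) :
    best.1 ≤ (M.exhaust letters low comp l x best).val.1 := by
  induction l generalizing x best with
  | nil =>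
    simp only [exhaust, Timed.bind_val]
    split_ifs with h
    · exact h.le
    · exact le_rfl
  | cons v l ih =>
    rw [exhaust_cons_val]
    exact List.foldlRecOn (motive := fun b => best.1 ≤ b.1) letters _ le_rfl
      fun b hb a _ => hb.trans (ih _ b)

lemma score_le_exhaust_val (hletters : ∀ a, a ∈ letters) {l : List (Fin n)} {x y : Fin n → S}
    (hy : ∀ w, w ∉ l → y w = x w) (best : ℝ × (Fin n → S)) :
    (M.score low y comp 0).val ≤ (M.exhaust letters low comp l x best).val.1 := by
  induction l generalizing x best with
  | nil =>
    obtain rfl : y = x := funext fun w => hy w List.not_mem_nil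
    simp only [exhaust, Timed.bind_val]
    split_ifs with h
    · exact le_rfl
    · exact not_lt.1 h
  | cons v l ih =>
    rw [exhaust_cons_val]
    refine le_foldl_of_mem (g := Prod.fst) (fun b a => M.le_exhaust_val letters low comp l _ b)
      (hletters (y v)) (fun b => ih (fun w hw => ?_) b) best
    rcases eq_or_ne w v with rfl | hwv
    · rw [Function.update_self]
    · rw [Function.update_of_ne hwv, hy w (by simp [hwv, hw])]

lemma exhaust_time_le (hletters : letters ≠ []) {d : ℕ} (hd : ∀ v, (low v).length ≤ d)
    (l : List (Fin n)) (x : Fin n → S) (best : ℝ × (Fin n → S)) :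
    (M.exhaust letters low comp l x best).time ≤
      letters.length ^ l.length * (3 + comp.length * (4 + 2 * d) + 3 * l.length) := by
  have hs : 1 ≤ letters.length := List.length_pos_iff.2 hletters
  induction l generalizing x best with
  | nil =>
    simp only [exhaust, Timed.bind_time, tick_time]
    have := M.score_time_le hd x comp 0
    split_ifs <;> simp only [Timed.bind_time, tick_time, Timed.pure_time, List.length_nil] <;>
      linarith
  | cons v l ih =>
    simp only [exhaust, Timed.bind_time, tick_time]
    calc _ ≤ 1 + letters.length * (2 + letters.length ^ l.length *
            (3 + comp.length * (4 + 2 * d) + 3 * l.length)) := by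
          gcongr
          exact Timed.foldlM_time_le (fun b a => Nat.add_le_add_left (ih _ b) 2) letters best
      _ ≤ letters.length ^ (l.length + 1) * (3 + comp.length * (4 + 2 * d) + 3 * l.length) +
            3 * letters.length ^ (l.length + 1) := by
          have := Nat.le_mul_of_pos_right letters.length (Nat.pow_pos hs (n := l.length))
          rw [pow_succ']
          linarith
      _ = _ := by
          rw [List.length_cons]
          ring

lemma exhaust_self_spec (hletters : ∀ a, a ∈ letters) (x : Fin n → S) :
    ∃ y, (M.exhaust letters low comp comp x ((M.score low x comp 0).val, x)).val.2 = y ∧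
      (∀ w, w ∉ comp → y w = x w) ∧ ∀ z, (∀ w, w ∉ comp → z w = x w) →
        (M.score low z comp 0).val ≤ (M.score low y comp 0).val := by
  obtain ⟨y, hy, hval⟩ : ∃ y, (∀ w, w ∉ comp → y w = x w) ∧
      (M.exhaust letters low comp comp x ((M.score low x comp 0).val, x)).val =
        ((M.score low y comp 0).val, y) := by
    rcases M.exhaust_val_eq_or letters low comp comp x _ with h | h
    · exact ⟨x, fun _ _ => rfl, h⟩
    · exact h
  refine ⟨y, by rw [hval], hy, fun z hz => ?_⟩
  exact (M.score_le_exhaust_val hletters hz _).trans_eq (congrArg Prod.fst hval)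

end Exhaust

section Solve

/-- A state of `solve` in which the vertices of `seen` fill whole components of `(V, E \ B)`, and
`x` is an exact MAP assignment on each of these components. -/
structure IsSolved (B : Finset M.Edge) (seen : Finset (Fin n)) (x : Fin n → S) : Prop where
  closed : ∀ v ∈ seen, ∀ w, (M.cutGraph B).Adj v w → w ∈ seen
  energyOn_le : ∀ v ∈ seen, ∀ y, M.energyOn B ((M.cutGraph B).connectedComponentMk v) y ≤
    M.energyOn B ((M.cutGraph B).connectedComponentMk v) x

variable {M} {B : Finset M.Edge} {seen seen' : Finset (Fin n)} {x y : Fin n → S} {v : Fin n}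
  {comp : List (Fin n)} {letters : List S}

lemma IsSolved.extend (h : IsSolved M B seen x)
    (hcomp : IsExploreState (M.cutGraph B) seen v [] seen' comp)
    (hy : ∀ w, w ∉ comp → y w = x w)
    (hbest : ∀ z : Fin n → S, (∀ w, w ∉ comp → z w = x w) →
      (M.score (fun w => (M.keptAt B w).2) z comp 0).val ≤
        (M.score (fun w => (M.keptAt B w).2) y comp 0).val) : IsSolved M B seen' y := by
  classical
  have mem_comp : ∀ {w}, w ∈ comp ↔ (M.cutGraph B).Reachable v w :=
    hcomp.mem_iff_reachable h.closed
  have mem_seen' : ∀ {w}, w ∈ seen' ↔ w ∈ seen ∨ w ∈ comp := fun {w} => hcomp.mem_seen w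
  constructor
  · intro w hw z hwz
    rw [mem_seen'] at hw ⊢
    exact hw.imp (fun hw => h.closed w hw z hwz)
      fun hw => mem_comp.2 ((mem_comp.1 hw).trans hwz.reachable)
  · intro w hw z
    rcases mem_seen'.1 hw with hw | hw
    · have hold : ∀ u ∈ ((M.cutGraph B).connectedComponentMk w).supp, y u = x u := fun u hu =>
        hy u fun hu' => hcomp.notMem w
          (mem_comp.2 ((mem_comp.1 hu').trans (SimpleGraph.ConnectedComponent.exact hu))) hw
      exact (h.energyOn_le w hw z).trans_eq (M.energyOn_congr hold).symm
    · have hsupp : ∀ u, u ∈ comp ↔ u ∈ ((M.cutGraph B).connectedComponentMk w).supp := fun u =>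
        ⟨fun hu => SimpleGraph.ConnectedComponent.sound
            ((mem_comp.1 hu).symm.trans (mem_comp.1 hw)),
          fun hu => mem_comp.2
            ((mem_comp.1 hw).trans (SimpleGraph.ConnectedComponent.exact hu).symm)⟩
      have := hbest (fun u => if u ∈ comp then z u else x u) fun u hu => if_neg hu
      have hnodup : comp.Nodup := hcomp.nodup
      rw [M.score_keptAt hnodup hsupp, M.score_keptAt hnodup hsupp] at this
      refine (M.energyOn_congr fun u hu => ?_).trans_le this
      rw [if_pos ((hsupp u).2 hu)]

lemma isExploreState_component (B : Finset M.Edge) (hv : v ∉ seen) :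
    IsExploreState (M.cutGraph B) seen v []
      (explore (fun w => (M.keptAt B w).1) n [v] (insert v seen) []).val.1
      (explore (fun w => (M.keptAt B w).1) n [v] (insert v seen) []).val.2 :=
  (IsExploreState.init _ hv).explore (M.isAdjList_keptAt B) (by simp)

lemma IsSolved.energyOn_le_solve (h : IsSolved M B seen x) (hletters : ∀ a, a ∈ letters)
    {l : List (Fin n)} (hv : v ∈ seen ∨ v ∈ l) (y : Fin n → S) :
    M.energyOn B ((M.cutGraph B).connectedComponentMk v) y ≤
      M.energyOn B ((M.cutGraph B).connectedComponentMk v)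
        (M.solve letters (M.keptAt B) l seen x).val := by
  induction l generalizing seen x with
  | nil => exact h.energyOn_le v (by simpa using hv) y
  | cons u l ih =>
    simp only [solve, Timed.bind_val]
    split_ifs with hu
    · exact ih h (by grind)
    · have hcomp := isExploreState_component B hu
      obtain ⟨z, hz, hzx, hbest⟩ := M.exhaust_self_spec (low := fun w => (M.keptAt B w).2)
        (comp := (explore (fun w => (M.keptAt B w).1) n [u] (insert u seen) []).val.2) hletters x
      simp only [Timed.bind_val, hz]
      refine ih (h.extend hcomp hzx hbest) ?_
      rw [hcomp.mem_seen]
      have := hcomp.start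
      grind

/-- A bound on the number of steps that `solve` spends on a component of at most `m` vertices, in a
graph of degree at most `d`, over an alphabet of `s` letters. -/
def componentCost (d m s : ℕ) : ℕ :=
  5 + m * (11 + 5 * d) + s ^ m * (3 + m * (7 + 2 * d))

lemma solve_component_time_le (hletters : letters ≠ []) {m : ℕ}
    (hm : ∀ c : (M.cutGraph B).ConnectedComponent, c.supp.ncard ≤ m) (hv : v ∉ seen)
    (x : Fin n → S) :
    let r := explore (fun w => (M.keptAt B w).1) n [v] (insert v seen) []
    let s := M.score (fun w => (M.keptAt B w).2) x r.val.2 0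
    3 + (r.time + (3 * r.val.2.length + (s.time +
      (M.exhaust letters (fun w => (M.keptAt B w).2) r.val.2 r.val.2 x (s.val, x)).time))) ≤
      componentCost (doublingConstant M.graph) m letters.length := by
  intro r s
  have hr : IsExploreState (M.cutGraph B) seen v [] r.val.1 r.val.2 := isExploreState_component B hv
  have hlen : r.val.2.length ≤ m := by
    have hnodup : r.val.2.Nodup := hr.nodup
    rw [← List.toFinset_card_of_nodup hnodup, ← Set.ncard_coe_finset]
    refine (Set.ncard_le_ncard fun w hw => ?_).trans (hm ((M.cutGraph B).connectedComponentMk v))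
    exact SimpleGraph.ConnectedComponent.sound
      (hr.reachable w (by simpa using hw)).symm
  have hexplore := explore_time_le (M.length_keptAt_fst_le B) n [v] (insert v seen) []
  have hscore := M.score_time_le (M.length_keptAt_snd_le B) x r.val.2 0
  have hexhaust := M.exhaust_time_le (comp := r.val.2) hletters (M.length_keptAt_snd_le B) r.val.2 x
    (s.val, x)
  rw [List.length_nil, mul_zero, add_zero] at hexplore
  calc _ ≤ 3 + (1 + (5 + 3 * doublingConstant M.graph) * r.val.2.length +
          (3 * r.val.2.length + (1 + r.val.2.length * (3 + 2 * doublingConstant M.graph) +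
            letters.length ^ r.val.2.length * (3 + r.val.2.length *
              (4 + 2 * doublingConstant M.graph) + 3 * r.val.2.length)))) := by gcongr
    _ = componentCost (doublingConstant M.graph) r.val.2.length letters.length := by
      unfold componentCost
      ring
    _ ≤ componentCost (doublingConstant M.graph) m letters.length := by
      unfold componentCost
      gcongr
      exact List.length_pos_iff.2 hletters

lemma solve_time_le (hletters : letters ≠ []) {m : ℕ}
    (hm : ∀ c : (M.cutGraph B).ConnectedComponent, c.supp.ncard ≤ m) (l : List (Fin n))
    (seen : Finset (Fin n)) (x : Fin n → S) :
    (M.solve letters (M.keptAt B) l seen x).time ≤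
      1 + l.length * componentCost (doublingConstant M.graph) m letters.length := by
  induction l generalizing seen x with
  | nil => simp [solve]
  | cons v l ih =>
    simp only [solve, Timed.bind_time, tick_time, List.length_cons, add_one_mul]
    split_ifs with hv
    · have : 3 ≤ componentCost (doublingConstant M.graph) m letters.length := by
        unfold componentCost
        omega
      linarith [ih seen x]
    · simp only [Timed.bind_time, tick_time]
      grw [ih]
      linarith [solve_component_time_le hletters hm hv x]

end Solve

section Components

variable {M} {B : Finset M.Edge} {v w : Fin n}

lemma exists_mem_edge_of_reachable {γ : Type*} {c : M.Edge → γ}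
    (hc : ∀ e f, e ∉ B → f ∉ B → M.graph.lineGraph.Adj e f → c e = c f) {e : M.Edge} (he : e ∉ B)
    (hv : v ∈ e.1) (hvw : (M.cutGraph B).Reachable v w) :
    ∃ f, f ∉ B ∧ w ∈ f.1 ∧ c f = c e := by
  rw [SimpleGraph.reachable_iff_reflTransGen] at hvw
  induction hvw with
  | refl => exact ⟨e, he, hv, rfl⟩
  | @tail y z _ hyz ih =>
    obtain ⟨f, hf, hyf, hfe⟩ := ih
    obtain ⟨g, hg, hgyz⟩ := M.cutGraph_adj.1 hyz
    refine ⟨g, hg, by simp [hgyz], ?_⟩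
    rcases eq_or_ne g f with rfl | hgf
    · exact hfe
    · refine (hc g f hg hf ?_).trans hfe
      exact SimpleGraph.lineGraph_adj_iff_exists.2 ⟨hgf, y, by simp [hgyz], hyf⟩

lemma exists_edist_le_of_reachable {p : ℝ} {hp : p ∈ Set.Icc (0 : ℝ) 1} {K : ℕ}
    (hB : B ∈ (dbDim M.graph.lineGraph p hp K).support) (v : Fin n) :
    ∃ a, ∀ w, (M.cutGraph B).Reachable v w → M.graph.edist a w ≤ K := by
  obtain ⟨c, hdist, hconst⟩ :=
    exists_center_of_mem_support (fun q hq => le_of_mem_support_stopLaw hp hq) hB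
  by_cases hv : ∃ e : M.Edge, e ∉ B ∧ v ∈ e.1
  · obtain ⟨e, he, hve⟩ := hv
    refine ⟨M.lo (c e), fun w hw => ?_⟩
    obtain ⟨f, hf, hwf, hfe⟩ :=
      exists_mem_edge_of_reachable (c := c) (fun e f => hconst e (by simp) f (by simp)) he hve hw
    rw [← hfe]
    exact (edist_le_lineGraph_edist_add_one (M.mem_edge_iff.2 (Or.inl rfl)) hwf).trans
      (Order.add_one_le_of_lt (hdist f (by simp) hf))
  · refine ⟨v, fun w hw => ?_⟩
    rw [SimpleGraph.reachable_iff_reflTransGen] at hw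
    rcases hw.cases_head with rfl | ⟨u, hvu, -⟩
    · simp
    · obtain ⟨e, he, hvue⟩ := M.cutGraph_adj.1 hvu
      exact absurd ⟨e, he, by simp [hvue]⟩ hv

lemma ncard_component_le {p : ℝ} {hp : p ∈ Set.Icc (0 : ℝ) 1} {K : ℕ}
    (hB : B ∈ (dbDim M.graph.lineGraph p hp K).support)
    (c : (M.cutGraph B).ConnectedComponent) :
    c.supp.ncard ≤ doublingConstant M.graph ^ (Nat.log 2 K + 1) := by
  induction c using SimpleGraph.ConnectedComponent.ind with
  | _ v =>
    obtain ⟨a, ha⟩ := exists_edist_le_of_reachable hB v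
    refine (Set.ncard_le_ncard fun w hw => ?_).trans (ncard_ball_succ_le M.graph a K)
    rw [SimpleGraph.mem_ball_comm]
    exact (ha w (SimpleGraph.ConnectedComponent.exact hw).symm).trans_lt
      (Nat.cast_lt.2 K.lt_succ_self)

end Components

section Run

variable [Fintype S] [Nonempty S]

/-- The assignment that Mode computes from the set `B` of removed edges. -/
noncomputable def assembled (B : Finset M.Edge) : Fin n → S :=
  (M.solve Finset.univ.toList (M.keptAt B) (List.finRange n) ∅ fun _ => Classical.arbitrary S).val

lemma modeRun_map_val (p : ℝ) (hp : p ∈ Set.Icc (0 : ℝ) 1) (K : ℕ) :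
    (M.modeRun p hp K).map Timed.val =
      (dbDim M.graph.lineGraph p hp K).map fun B => (B, M.assembled B) := by
  rw [modeRun, map_val_andThen, decompRun_map_val, ← PMF.bind_pure_comp]
  refine congrArg _ (funext fun B => ?_)
  rw [PMF.pure_map]
  simp only [Timed.bind_val, Timed.pure_val, Function.comp, assembled,
    M.keepTable_val (B := B) (l := List.finRange n) (by simp)]

lemma isComponentMAP_assembled (B : Finset M.Edge) : M.IsComponentMAP B (M.assembled B) := by
  intro c y
  induction c using SimpleGraph.ConnectedComponent.ind with
  | _ v =>
    have hempty : IsSolved M B ∅ fun _ => Classical.arbitrary S := ⟨by simp, by simp⟩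
    exact hempty.energyOn_le_solve (by simp) (Or.inr (List.mem_finRange v)) y

lemma isModeLaw_modeRun (p : ℝ) (hp : p ∈ Set.Icc (0 : ℝ) 1) (K : ℕ) :
    M.IsModeLaw p hp K ((M.modeRun p hp K).map Timed.val) := by
  rw [modeRun_map_val]
  refine ⟨?_, fun z hz => ?_⟩
  · rw [PMF.map_comp]
    exact PMF.map_id _
  · obtain ⟨B, -, rfl⟩ := (PMF.mem_support_map_iff _ _ _).1 hz
    exact M.isComponentMAP_assembled B

variable {M} {p : ℝ} {hp : p ∈ Set.Icc (0 : ℝ) 1} {K : ℕ} {r : Timed (Finset M.Edge × (Fin n → S))}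

lemma modeRun_time_le (hr : r ∈ (M.modeRun p hp K).support) :
    r.time ≤ 6 + Fintype.card M.Edge * (4 * K + 14 + 4 * doublingConstant M.graph +
      (5 + 6 * doublingConstant M.graph) * doublingConstant M.graph ^ (Nat.log 2 K + 2)) +
      n * (6 + 4 * doublingConstant M.graph + componentCost (doublingConstant M.graph)
        (doublingConstant M.graph ^ (Nat.log 2 K + 1)) (Fintype.card S)) := by
  rw [modeRun, mem_support_andThen] at hr
  obtain ⟨t, ht, y, hy, rfl⟩ := hr
  obtain rfl := (PMF.mem_support_pure_iff _ _).1 hy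
  have hB : t.val ∈ (dbDim M.graph.lineGraph p hp K).support := by
    rw [← decompRun_map_val]
    exact (PMF.mem_support_map_iff _ _ _).2 ⟨t, ht, rfl⟩
  have hdecomp := M.decompRun_time_le ht
  have htable := M.keepTable_time_le t.val (List.finRange n) fun _ => ([], [])
  have hsolve := solve_time_le (letters := Finset.univ.toList (α := S))
    (by simp [Finset.univ_nonempty.ne_empty])
    (ncard_component_le hB) (List.finRange n) ∅ fun _ => Classical.arbitrary S
  rw [List.length_finRange, Finset.length_toList, Finset.card_univ] at hsolve
  rw [List.length_finRange] at htable
  simp only [Timed.bind_time, Timed.pure_time, tick_time,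
    M.keepTable_val (B := t.val) (l := List.finRange n) (by simp)]
  linarith

lemma decomposition_cost_le {K l m : ℕ} (hK : 1 ≤ K) (hl : 1 ≤ l) (hm : 1 ≤ m) :
    4 * K + 14 + 4 * l + (5 + 6 * l) * (l * m) ≤ 33 * (K * (l * l) * m) := by
  calc _ = 4 * (K * (1 * 1) * 1) + 14 * (1 * (1 * 1) * 1) + 4 * (1 * (l * 1) * 1) +
          5 * (1 * (l * 1) * m) + 6 * (1 * (l * l) * m) := by ring
    _ ≤ 4 * (K * (l * l) * m) + 14 * (K * (l * l) * m) + 4 * (K * (l * l) * m) +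
          5 * (K * (l * l) * m) + 6 * (K * (l * l) * m) := by gcongr
    _ = _ := by ring

lemma componentCost_add_le {l m s : ℕ} (hl : 1 ≤ l) (hm : 1 ≤ m) (hs : 1 ≤ s) :
    6 + 4 * l + componentCost l m s ≤ 43 * (l * m * s ^ m) := by
  have hpow : 1 ≤ s ^ m := Nat.one_le_pow _ _ hs
  unfold componentCost
  calc _ = 11 * (1 * 1 * 1) + 4 * (l * 1 * 1) + 11 * (1 * m * 1) + 5 * (l * m * 1) +
          3 * (1 * 1 * s ^ m) + 7 * (1 * m * s ^ m) + 2 * (l * m * s ^ m) := by ring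
    _ ≤ 11 * (l * m * s ^ m) + 4 * (l * m * s ^ m) + 11 * (l * m * s ^ m) + 5 * (l * m * s ^ m) +
          3 * (l * m * s ^ m) + 7 * (l * m * s ^ m) + 2 * (l * m * s ^ m) := by gcongr
    _ = _ := by ring

lemma modeRun_time_le_mul (hr : r ∈ (M.modeRun p hp K).support) {s : ℕ} (hs : Fintype.card S ≤ s)
    (hs2 : 2 ≤ s) (hK : 1 ≤ K) (hn : 0 < n) :
    r.time ≤ 82 * (n * doublingConstant M.graph) * s ^ (K + 2 * doublingConstant M.graph +
      2 * doublingConstant M.graph ^ (Nat.log 2 K + 1)) := by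
  have : Nonempty (Fin n) := ⟨⟨0, hn⟩⟩
  have hE : Fintype.card M.Edge ≤ n * doublingConstant M.graph := by
    simpa using card_edgeSet_le M.graph
  have hl := one_le_doublingConstant M.graph
  have hm : 1 ≤ doublingConstant M.graph ^ (Nat.log 2 K + 1) := Nat.one_le_pow _ _ hl
  have htime := modeRun_time_le hr
  rw [pow_succ' _ (Nat.log 2 K + 1)] at htime
  generalize doublingConstant M.graph = l at *
  generalize l ^ (Nat.log 2 K + 1) = m at *
  have hpow : 1 ≤ s ^ m := Nat.one_le_pow _ _ (by omega)
  have self_le_pow : ∀ a : ℕ, a ≤ s ^ a := fun a => (Nat.lt_pow_self (by omega)).le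
  calc r.time ≤ 6 * (1 * 1 * (1 * (1 * 1) * 1 * 1)) +
          n * l * (33 * (K * (l * l) * m)) + n * (43 * (l * m * s ^ m)) := by
        grw [htime, hE, decomposition_cost_le hK hl hm, ← componentCost_add_le hl hm (by omega)]
        unfold componentCost
        gcongr
    _ = 6 * (1 * 1 * (1 * (1 * 1) * 1 * 1)) + 33 * (n * l * (K * (l * l) * m * 1)) +
          43 * (n * l * (1 * (1 * 1) * m * s ^ m)) := by ring
    _ ≤ 6 * (n * l * (K * (l * l) * m * s ^ m)) + 33 * (n * l * (K * (l * l) * m * s ^ m)) +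
          43 * (n * l * (K * (l * l) * m * s ^ m)) := by gcongr; exact hn
    _ = 82 * (n * l) * (K * (l * l) * m * s ^ m) := by ring
    _ ≤ 82 * (n * l) * (s ^ K * (s ^ l * s ^ l) * s ^ m * s ^ m) := by
        gcongr <;> exact self_le_pow _
    _ = _ := by ring

end Run

end MRF

lemma sum_toReal_filter_le {α : Type*} [Fintype α] (μ : PMF α) {t : Set α} [DecidablePred (· ∈ t)]
    {ε : ℝ} (hε : 0 ≤ ε) (h : μ.toOuterMeasure t ≤ ENNReal.ofReal ε) :
    ∑ z with z ∈ t, (μ z).toReal ≤ ε := by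
  rw [← ENNReal.toReal_sum fun z _ => μ.apply_ne_top z]
  refine ENNReal.toReal_le_of_le_ofReal hε ((le_of_eq ?_).trans h)
  rw [PMF.toOuterMeasure_apply_fintype, Finset.sum_filter]
  exact Finset.sum_congr rfl fun z _ => (Set.indicator_apply _ _ _).symm

lemma sum_toReal_mul_sum_le {α β : Type*} [Fintype α] [Fintype β] (μ : PMF α) (s : α → Finset β)
    {w : β → ℝ} (hw : ∀ b, 0 ≤ w b) {ε : ℝ} (hε : 0 ≤ ε)
    (h : ∀ b, (μ.map s).toOuterMeasure {t | b ∈ t} ≤ ENNReal.ofReal ε) :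
    ∑ z, (μ z).toReal * ∑ b ∈ s z, w b ≤ ε * ∑ b, w b := by
  classical
  calc ∑ z, (μ z).toReal * ∑ b ∈ s z, w b = ∑ z, ∑ b ∈ s z, (μ z).toReal * w b := by
        simp only [Finset.mul_sum]
    _ = ∑ b, ∑ z with b ∈ s z, (μ z).toReal * w b := Finset.sum_comm' (by simp)
    _ = ∑ b, (∑ z with z ∈ s ⁻¹' {t | b ∈ t}, (μ z).toReal) * w b := by
        simp only [Finset.sum_mul, Set.mem_preimage, Set.mem_ofPred_eq]
    _ ≤ ∑ b, ε * w b := by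
        gcongr with b
        · exact hw b
        · exact sum_toReal_filter_le μ hε ((PMF.toOuterMeasure_map_apply _ _ _).symm.trans_le (h b))
    _ = ε * ∑ b, w b := (Finset.mul_sum _ _ _).symm

namespace MRF

variable {n : ℕ} {S : Type} (M : MRF n S)

section Loss

lemma energy_eq (B : Finset M.Edge) [Fintype (M.cutGraph B).ConnectedComponent] (x : Fin n → S) :
    M.energy x = ∑ c, M.energyOn B c x + ∑ e ∈ B, M.edgePot e (x (M.lo e)) (x (M.hi e)) := by
  classical
  unfold energyOn energy
  rw [Finset.sum_add_distrib, add_assoc]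
  congr 1
  · exact (Finset.sum_fiberwise _ _ _).symm
  · rw [← Finset.sum_compl_add_sum B]
    congr 1
    rw [← Finset.sum_fiberwise _ fun e => (M.cutGraph B).connectedComponentMk (M.lo e)]
    refine Finset.sum_congr rfl fun c _ => Finset.sum_congr ?_ fun _ _ => rfl
    ext e
    simp

lemma energy_sub_le {B : Finset M.Edge} {x : Fin n → S} (hx : M.IsComponentMAP B x)
    (y : Fin n → S) :
    M.energy y - M.energy x ≤ ∑ e ∈ B, M.edgePot e (y (M.lo e)) (y (M.hi e)) := by
  have : Fintype (M.cutGraph B).ConnectedComponent := Fintype.ofFinite _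
  have hcomp : ∑ c, M.energyOn B c y ≤ ∑ c, M.energyOn B c x :=
    Finset.sum_le_sum fun c _ => hx c y
  have hcut : 0 ≤ ∑ e ∈ B, M.edgePot e (x (M.lo e)) (x (M.hi e)) :=
    Finset.sum_nonneg fun e _ => M.edgePot_nonneg _ _ _
  rw [M.energy_eq B, M.energy_eq B x]
  linarith

variable {p : ℝ} {hp : p ∈ Set.Icc (0 : ℝ) 1} {K : ℕ}

lemma expected_loss_le [Fintype S] {ε : ℝ} (hε : 0 ≤ ε)
    (hcut : ∀ e : M.Edge,
      (dbDim M.graph.lineGraph p hp K).toOuterMeasure {B | e ∈ B} ≤ ENNReal.ofReal ε)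
    {μ : PMF (Finset M.Edge × (Fin n → S))} (hμ : M.IsModeLaw p hp K μ) (y : Fin n → S) :
    ∑ z, (μ z).toReal * (M.energy y - M.energy z.2) ≤ ε * M.energy y := by
  calc ∑ z, (μ z).toReal * (M.energy y - M.energy z.2)
      ≤ ∑ z, (μ z).toReal * ∑ e ∈ z.1, M.edgePot e (y (M.lo e)) (y (M.hi e)) := by
        refine Finset.sum_le_sum fun z _ => ?_
        rcases eq_or_ne (μ z) 0 with hz | hz
        · simp [hz]
        · gcongr
          exact M.energy_sub_le (hμ.2 z hz) y
    _ ≤ ε * ∑ e : M.Edge, M.edgePot e (y (M.lo e)) (y (M.hi e)) :=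
        sum_toReal_mul_sum_le μ Prod.fst (fun e => M.edgePot_nonneg e _ _) hε (hμ.1 ▸ hcut)
    _ ≤ ε * M.energy y := by
        gcongr
        exact le_add_of_nonneg_left (Finset.sum_nonneg fun v _ => M.nodePot_nonneg v _)

lemma dbDim_lineGraph_mem_le (e : M.Edge) :
    (dbDim M.graph.lineGraph p hp K).toOuterMeasure {B | e ∈ B} ≤
      ENNReal.ofReal (p + (1 - p) ^ (K - 1) *
        (doublingConstant M.graph : ℝ) ^ (Nat.log 2 K + 2)) := by
  have hsphere : (spherePart M.graph.lineGraph Finset.univ e K).card ≤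
      doublingConstant M.graph ^ (Nat.log 2 K + 2) := by
    rw [← Set.ncard_coe_finset]
    refine (Set.ncard_le_ncard fun f hf => ?_).trans (ncard_lineGraph_ball_succ_le M.graph e K)
    rw [SimpleGraph.mem_ball_comm]
    exact (mem_spherePart.1 hf).2.trans_lt (Nat.cast_lt.2 K.lt_succ_self)
  have hp' : 0 ≤ 1 - p := sub_nonneg.2 hp.2
  calc (dbDim M.graph.lineGraph p hp K).toOuterMeasure {B | e ∈ B}
      = cutProb M.graph.lineGraph (stopLaw p hp K) Finset.univ ∅ e := rfl
    _ ≤ ENNReal.ofReal p +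
          stopLaw p hp K K * (spherePart M.graph.lineGraph Finset.univ e K).card :=
        cutProb_le (fun q hq => le_of_mem_support_stopLaw hp hq)
          (fun j hj => stopLaw_le_mul_Ici hp hj) (Finset.mem_univ e) (Finset.notMem_empty e)
    _ ≤ ENNReal.ofReal p + stopLaw p hp K K *
          (doublingConstant M.graph ^ (Nat.log 2 K + 2) : ℕ) := by gcongr
    _ = _ := by
        rw [stopLaw_self, ENNReal.ofReal_add hp.1 (by positivity),
          ENNReal.ofReal_mul (by positivity), ← Nat.cast_pow, ENNReal.ofReal_natCast]

end Loss

end MRF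

section Parameters

lemma rate_pos {ε : ℝ} (hε : 0 < ε) (ρ : ℝ) : 0 < rate ε ρ := by
  unfold rate
  positivity

lemma rate_le {ε ρ : ℝ} (hε : 0 ≤ ε) (hρ : 1 ≤ ρ) : rate ε ρ ≤ ε / 16 := by
  calc ε * (2 : ℝ) ^ (-ρ - 3) ≤ ε * (2 : ℝ) ^ (-4 : ℝ) := by
        gcongr
        · norm_num
        · linarith
    _ = ε / 16 := by
        rw [Real.rpow_neg (by norm_num)]
        norm_num
        ring

lemma log_rate {ε : ℝ} (hε : 0 < ε) (ρ : ℝ) :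
    Real.log (rate ε ρ) = -(Real.log (1 / ε) + (ρ + 3) * Real.log 2) := by
  rw [rate, Real.log_mul hε.ne' (by positivity), Real.log_rpow (by norm_num), one_div,
    Real.log_inv]
  ring

variable {φ ρ : ℝ}

lemma le_twentyfour_mul_div (hφ0 : 0 < φ) (hφ : φ ≤ 1 / 16) (hρ : 1 ≤ ρ) :
    384 ≤ 24 * ρ / φ := by
  rw [le_div_iff₀ hφ0]
  linarith

lemma one_le_log_twentyfour_mul_div (hφ0 : 0 < φ) (hφ : φ ≤ 1 / 16) (hρ : 1 ≤ ρ) :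
    1 ≤ Real.log (24 * ρ / φ) := by
  have hL := le_twentyfour_mul_div hφ0 hφ hρ
  rw [Real.le_log_iff_exp_le (by linarith)]
  linarith [Real.exp_one_lt_d9]

lemma two_mul_radius_eq (φ ρ : ℝ) :
    2 * radius φ ρ = 24 * ρ / φ * Real.log (24 * ρ / φ) := by
  unfold radius
  ring

lemma le_radius (hφ0 : 0 < φ) (hφ : φ ≤ 1 / 16) (hρ : 1 ≤ ρ) : 192 ≤ radius φ ρ := by
  have hL := le_twentyfour_mul_div hφ0 hφ hρ
  have hlog := one_le_log_twentyfour_mul_div hφ0 hφ hρ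
  have := two_mul_radius_eq φ ρ
  nlinarith

lemma two_mul_radius_le_sq (hφ0 : 0 < φ) (hρ : 0 ≤ ρ) :
    2 * radius φ ρ ≤ (24 * ρ / φ) ^ 2 := by
  have hL : 0 ≤ 24 * ρ / φ := by positivity
  rw [two_mul_radius_eq, sq]
  exact mul_le_mul_of_nonneg_left (Real.log_le_self hL) hL

lemma one_le_ceil_radius (hφ0 : 0 < φ) (hφ : φ ≤ 1 / 16) (hρ : 1 ≤ ρ) : 1 ≤ ⌈radius φ ρ⌉₊ :=
  Nat.one_le_ceil_iff.2 (by linarith [le_radius hφ0 hφ hρ])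

lemma ceil_radius_le (hφ0 : 0 < φ) (hφ : φ ≤ 1 / 16) (hρ : 1 ≤ ρ) :
    (⌈radius φ ρ⌉₊ : ℝ) ≤ 2 * radius φ ρ := by
  have hR := le_radius hφ0 hφ hρ
  have := Nat.ceil_lt_add_one (show 0 ≤ radius φ ρ by linarith)
  linarith

lemma doublingConstant_le_rpow {V : Type*} [Finite V] [Nonempty V] {G : SimpleGraph V}
    (h : doublingDim G ≤ ρ) : (doublingConstant G : ℝ) ≤ 2 ^ ρ :=
  (Real.logb_le_iff_le_rpow one_lt_two (Nat.cast_pos.2 (one_le_doublingConstant G))).1 h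

lemma pow_log_add_le {a : ℝ} (ha : 0 ≤ a) (haρ : a ≤ 2 ^ ρ) (hρ : 0 ≤ ρ) {K : ℕ} (hK : K ≠ 0)
    (j : ℕ) : a ^ (Nat.log 2 K + j) ≤ (2 ^ j * K) ^ ρ := by
  calc a ^ (Nat.log 2 K + j) ≤ ((2 : ℝ) ^ ρ) ^ (Nat.log 2 K + j) := by gcongr
    _ = ((2 : ℝ) ^ (Nat.log 2 K + j)) ^ ρ := Real.rpow_pow_comm (by norm_num) _ _
    _ = (2 ^ j * (2 ^ Nat.log 2 K : ℕ)) ^ ρ := by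
        rw [add_comm, pow_add]
        norm_cast
    _ ≤ (2 ^ j * K) ^ ρ := by
        gcongr
        exact Nat.pow_log_le_self 2 hK

lemma one_sub_pow_le_exp {x : ℝ} (hx : x ≤ 1) (m : ℕ) : (1 - x) ^ m ≤ Real.exp (-(x * m)) := by
  calc (1 - x) ^ m ≤ Real.exp (-x) ^ m :=
        pow_le_pow_left₀ (sub_nonneg.2 hx) (Real.one_sub_le_exp_neg x) m
    _ = Real.exp (-(x * m)) := by
        rw [← Real.exp_nat_mul]
        ring_nf

lemma pow_log_ceil_radius_le (hφ0 : 0 < φ) (hφ : φ ≤ 1 / 16) (hρ : 1 ≤ ρ) {a : ℝ} (ha : 0 ≤ a)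
    (haρ : a ≤ 2 ^ ρ) :
    a ^ (Nat.log 2 ⌈radius φ ρ⌉₊ + 2) ≤ Real.exp (3 * ρ * Real.log (24 * ρ / φ)) := by
  have hL := le_twentyfour_mul_div hφ0 hφ hρ
  have hceil : (2 : ℝ) ^ 2 * ⌈radius φ ρ⌉₊ ≤ (24 * ρ / φ) ^ 3 := by
    have h1 := ceil_radius_le hφ0 hφ hρ
    have h2 := two_mul_radius_le_sq hφ0 (show 0 ≤ ρ by linarith)
    nlinarith [sq_nonneg (24 * ρ / φ)]
  calc a ^ (Nat.log 2 ⌈radius φ ρ⌉₊ + 2) ≤ (2 ^ 2 * ⌈radius φ ρ⌉₊) ^ ρ :=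
        pow_log_add_le ha haρ (by linarith)
          (Nat.one_le_iff_ne_zero.1 (one_le_ceil_radius hφ0 hφ hρ)) 2
    _ ≤ ((24 * ρ / φ) ^ 3) ^ ρ := by gcongr
    _ = Real.exp (3 * ρ * Real.log (24 * ρ / φ)) := by
        rw [Real.rpow_def_of_pos (by positivity), Real.log_pow]
        push_cast
        ring_nf

lemma one_sub_pow_mul_pow_log_ceil_radius_le (hφ0 : 0 < φ) (hφ : φ ≤ 1 / 16) (hρ : 1 ≤ ρ) {a : ℝ}
    (ha : 0 ≤ a) (haρ : a ≤ 2 ^ ρ) :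
    (1 - φ) ^ (⌈radius φ ρ⌉₊ - 1) * a ^ (Nat.log 2 ⌈radius φ ρ⌉₊ + 2) ≤ φ := by
  have hlog := one_le_log_twentyfour_mul_div hφ0 hφ hρ
  have hexponent : -(φ * (⌈radius φ ρ⌉₊ - 1 : ℕ)) + 3 * ρ * Real.log (24 * ρ / φ) ≤
      -Real.log (24 * ρ / φ) := by
    have hradius : φ * radius φ ρ = 12 * ρ * Real.log (24 * ρ / φ) := by
      unfold radius
      field_simp
    have hceil : φ * radius φ ρ ≤ φ * ⌈radius φ ρ⌉₊ := by
      gcongr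
      exact Nat.le_ceil _
    rw [Nat.cast_pred (one_le_ceil_radius hφ0 hφ hρ)]
    nlinarith
  calc (1 - φ) ^ (⌈radius φ ρ⌉₊ - 1) * a ^ (Nat.log 2 ⌈radius φ ρ⌉₊ + 2)
      ≤ Real.exp (-(φ * (⌈radius φ ρ⌉₊ - 1 : ℕ))) *
          Real.exp (3 * ρ * Real.log (24 * ρ / φ)) := by
        gcongr
        · exact one_sub_pow_le_exp (by linarith) _
        · exact pow_log_ceil_radius_le hφ0 hφ hρ ha haρ
    _ ≤ Real.exp (-Real.log (24 * ρ / φ)) := by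
        rw [← Real.exp_add]
        exact Real.exp_le_exp.2 hexponent
    _ = φ / (24 * ρ) := by rw [Real.exp_neg, Real.exp_log (by positivity), inv_div]
    _ ≤ φ := div_le_self hφ0.le (by linarith)

lemma add_two_mul_le_rpow {R : ℝ} (hR : 20 ≤ R) (hρ : 1 ≤ ρ) {k a b : ℝ} (hk0 : 0 ≤ k)
    (hk : k ≤ 2 * R) (ha : a ≤ 2 ^ ρ) (hb : b ≤ (2 * k) ^ ρ) :
    k + 2 * a + 2 * b ≤ R ^ (2 * ρ) := by
  have hk' : k ≤ (4 * R) ^ ρ :=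
    (by linarith : k ≤ 4 * R).trans (Real.self_le_rpow_of_one_le (by linarith) hρ)
  have ha' : a ≤ (4 * R) ^ ρ := ha.trans (by gcongr; linarith)
  have hb' : b ≤ (4 * R) ^ ρ := hb.trans (by gcongr ?_ ^ ρ; linarith)
  calc k + 2 * a + 2 * b ≤ 5 * (4 * R) ^ ρ := by linarith
    _ ≤ 5 ^ ρ * (4 * R) ^ ρ := by
        gcongr
        exact Real.self_le_rpow_of_one_le (by norm_num) hρ
    _ = (5 * (4 * R)) ^ ρ := (Real.mul_rpow (by norm_num) (by linarith)).symm
    _ ≤ (R ^ 2) ^ ρ := by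
        gcongr
        nlinarith
    _ = R ^ (2 * ρ) := by
        rw [← Real.rpow_natCast, ← Real.rpow_mul (by linarith)]
        norm_num

lemma radius_rpow_le {ε : ℝ} (hρ : 1 ≤ ρ) (h0 : 0 < ε) (h1 : ε ≤ 1) :
    radius (rate ε ρ) ρ ^ (2 * ρ) ≤ Real.exp (36 * (ρ * (ρ + Real.log (1 / ε)))) := by
  have hφ0 : 0 < rate ε ρ := rate_pos h0 ρ
  have hφ : rate ε ρ ≤ 1 / 16 := (rate_le h0.le hρ).trans (by linarith)
  have hR := le_radius hφ0 hφ hρ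
  have hε : 0 ≤ Real.log (1 / ε) := Real.log_nonneg (one_le_one_div h0 h1)
  have hlogL : Real.log (24 * ρ / rate ε ρ) ≤ 9 * (ρ + Real.log (1 / ε)) := by
    have hlog24 : Real.log 24 ≤ 5 * Real.log 2 := by
      rw [← Real.log_rpow two_pos]
      exact Real.log_le_log (by norm_num) (by norm_num)
    have hlogρ : Real.log ρ ≤ ρ - 1 := Real.log_le_sub_one_of_pos (by linarith)
    have hlog2 : Real.log 2 < 0.7 := Real.log_two_lt_d9.trans (by norm_num)
    rw [Real.log_div (by positivity) hφ0.ne', Real.log_mul (by norm_num) (by positivity),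
      log_rate h0]
    nlinarith
  have hlogR : Real.log (radius (rate ε ρ) ρ) ≤ 2 * Real.log (24 * ρ / rate ε ρ) := by
    have hsq := two_mul_radius_le_sq hφ0 (show 0 ≤ ρ by linarith)
    rw [← Real.log_rpow (by positivity), Real.rpow_ofNat]
    exact Real.log_le_log (by linarith) (by linarith)
  rw [Real.rpow_def_of_pos (by linarith), Real.exp_le_exp]
  calc Real.log (radius (rate ε ρ) ρ) * (2 * ρ)
      ≤ 2 * (9 * (ρ + Real.log (1 / ε))) * (2 * ρ) := by gcongr; linarith
    _ = 36 * (ρ * (ρ + Real.log (1 / ε))) := by ring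

end Parameters

namespace MRF

section Bounds

variable {n : ℕ} {S : Type} {M : MRF n S} [Fintype S] {ρ ε : ℝ}

lemma expected_loss_le_of_doublingDim_le (hρ : 1 ≤ ρ) (h0 : 0 < ε) (h1 : ε < 1) (hn : 0 < n)
    (hdim : doublingDim M.graph ≤ ρ) {μ : PMF (Finset M.Edge × (Fin n → S))}
    (hμ : M.IsModeLaw (rate ε ρ) (rate_mem h0 h1 hρ) ⌈radius (rate ε ρ) ρ⌉₊ μ) (y : Fin n → S) :
    ∑ z, (μ z).toReal * (M.energy y - M.energy z.2) ≤ ε * M.energy y := by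
  have : Nonempty (Fin n) := ⟨⟨0, hn⟩⟩
  have hφ := rate_le h0.le hρ
  have hcut := one_sub_pow_mul_pow_log_ceil_radius_le (rate_pos h0 ρ) (by linarith) hρ
    (Nat.cast_nonneg _) (doublingConstant_le_rpow hdim)
  exact M.expected_loss_le h0.le
    (fun e => (M.dbDim_lineGraph_mem_le e).trans (ENNReal.ofReal_le_ofReal (by linarith))) hμ y

lemma modeRun_time_le_rpow [Nonempty S] (hρ : 1 ≤ ρ) (h0 : 0 < ε) (h1 : ε < 1) (hn : 0 < n)
    (hdim : doublingDim M.graph ≤ ρ) {s : ℕ} (hs : Fintype.card S ≤ s) (hs2 : 2 ≤ s)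
    {r : Timed (Finset M.Edge × (Fin n → S))}
    (hr : r ∈ (M.modeRun (rate ε ρ) (rate_mem h0 h1 hρ) ⌈radius (rate ε ρ) ρ⌉₊).support) :
    (r.time : ℝ) ≤ 82 * (n * (2 : ℝ) ^ ρ * (s : ℝ) ^ (radius (rate ε ρ) ρ ^ (2 * ρ))) := by
  have : Nonempty (Fin n) := ⟨⟨0, hn⟩⟩
  have hφ0 : 0 < rate ε ρ := rate_pos h0 ρ
  have hφ : rate ε ρ ≤ 1 / 16 := (rate_le h0.le hρ).trans (by linarith)
  have hK := one_le_ceil_radius hφ0 hφ hρ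
  have hl := doublingConstant_le_rpow hdim
  have hm := pow_log_add_le (Nat.cast_nonneg _) hl (by linarith) (Nat.one_le_iff_ne_zero.1 hK) 1
  have hR := le_radius hφ0 hφ hρ
  have hexponent := add_two_mul_le_rpow (by linarith) hρ (Nat.cast_nonneg _)
    (ceil_radius_le hφ0 hφ hρ) hl (by simpa using hm)
  have htime := modeRun_time_le_mul hr hs hs2 hK hn
  have hs1 : (1 : ℝ) ≤ s := by exact_mod_cast (by omega : 1 ≤ s)
  calc (r.time : ℝ) ≤ _ := Nat.cast_le.2 htime
    _ = 82 * (n * doublingConstant M.graph * (s : ℝ) ^ ((⌈radius (rate ε ρ) ρ⌉₊ +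
          2 * doublingConstant M.graph + 2 * (doublingConstant M.graph : ℝ) ^
            (Nat.log 2 ⌈radius (rate ε ρ) ρ⌉₊ + 1)) : ℝ)) := by
        push_cast
        rw [← Real.rpow_natCast]
        push_cast
        ring
    _ ≤ _ := by gcongr

end Bounds

end MRF

section Asymptotics

lemma eventually_rpow_sqrt_log_le {s : ℝ} (hs : 0 < s) {δ c : ℝ} (hδ : 0 < δ) (hc : 0 < c) :
    ∀ᶠ x : ℝ in atTop, s ^ √(Real.log x) ≤ c * x ^ δ := by
  have hsqrt : Tendsto (fun x => √(Real.log x)) atTop atTop :=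
    Real.tendsto_sqrt_atTop.comp Real.tendsto_log_atTop
  have hquad : Tendsto (fun y : ℝ => y * (δ * y - Real.log s)) atTop atTop :=
    tendsto_id.atTop_mul_atTop₀
      (tendsto_atTop_add_const_right _ _ (tendsto_id.const_mul_atTop hδ))
  filter_upwards [(hquad.comp hsqrt).eventually_ge_atTop (-Real.log c), eventually_ge_atTop 1]
    with x hx hx1
  have hsq : √(Real.log x) * √(Real.log x) = Real.log x := Real.mul_self_sqrt (Real.log_nonneg hx1)
  rw [Function.comp_apply] at hx
  calc s ^ √(Real.log x) = Real.exp (Real.log s * √(Real.log x)) := Real.rpow_def_of_pos hs _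
    _ ≤ Real.exp (Real.log c + Real.log x * δ) := by
        rw [Real.exp_le_exp]
        linear_combination hx + δ * hsq
    _ = c * x ^ δ := by rw [Real.exp_add, Real.exp_log hc, Real.rpow_def_of_pos (by linarith)]

variable {ι : Type*} {l : Filter ι}

lemma eventually_exp_le_sqrt_log {τ x : ι → ℝ} (hx : Tendsto x l atTop)
    (hτ : τ =o[l] fun i => Real.log (Real.log (x i))) (a : ℝ) :
    ∀ᶠ i in l, Real.exp (a * τ i) ≤ √(Real.log (x i)) := by
  have hlog : Tendsto (fun i => Real.log (x i)) l atTop := Real.tendsto_log_atTop.comp hx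
  filter_upwards [(hτ.const_mul_left a).def (half_pos one_pos), hlog.eventually_ge_atTop 1]
    with i hi hlogx
  have hpos : 0 < Real.log (x i) := by linarith
  rw [Real.norm_of_nonneg (Real.log_nonneg hlogx)] at hi
  rw [← Real.le_log_iff_exp_le (Real.sqrt_pos.2 hpos), Real.log_sqrt hpos.le]
  linarith [le_abs_self (a * τ i), Real.norm_eq_abs (a * τ i)]

variable {n : ι → ℕ} {ρ ε : ι → ℝ}

lemma eventually_two_rpow_mul_rpow_le (hρ : ∀ i, 1 ≤ ρ i) (h0 : ∀ i, 0 < ε i)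
    (h1 : ∀ i, ε i ≤ 1) (hn : Tendsto n l atTop)
    (ho : (fun i => ρ i * (ρ i + Real.log (1 / ε i))) =o[l] fun i => Real.log (Real.log (n i)))
    {s : ℝ} (hs : 2 ≤ s) {δ c : ℝ} (hδ : 0 < δ) (hc : 0 < c) :
    ∀ᶠ i in l, (2 : ℝ) ^ ρ i * s ^ (radius (rate (ε i) (ρ i)) (ρ i) ^ (2 * ρ i)) ≤
      c * (n i : ℝ) ^ δ := by
  have hnR : Tendsto (fun i => (n i : ℝ)) l atTop := tendsto_natCast_atTop_atTop.comp hn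
  filter_upwards [eventually_exp_le_sqrt_log hnR ho 36,
    hnR.eventually (eventually_rpow_sqrt_log_le (show 0 < s * s by positivity) hδ hc)] with i hi hx
  have hε : 0 ≤ Real.log (1 / ε i) := Real.log_nonneg (one_le_one_div (h0 i) (h1 i))
  have hρi := hρ i
  have hexponent := (radius_rpow_le hρi (h0 i) (h1 i)).trans hi
  have hρn : ρ i ≤ √(Real.log (n i)) := by
    have hτ : ρ i ≤ ρ i * (ρ i + Real.log (1 / ε i)) :=
      le_mul_of_one_le_right (by linarith) (by linarith)
    linarith [Real.add_one_le_exp (36 * (ρ i * (ρ i + Real.log (1 / ε i))))]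
  calc (2 : ℝ) ^ ρ i * s ^ (radius (rate (ε i) (ρ i)) (ρ i) ^ (2 * ρ i))
      ≤ s ^ √(Real.log (n i)) * s ^ √(Real.log (n i)) := by
        gcongr
        · calc (2 : ℝ) ^ ρ i ≤ s ^ ρ i := by gcongr
            _ ≤ s ^ √(Real.log (n i)) := by
              gcongr
              linarith
        · linarith
    _ = (s * s) ^ √(Real.log (n i)) := (Real.mul_rpow (by linarith) (by linarith)).symm
    _ ≤ c * (n i : ℝ) ^ δ := hx

lemma MRF.eventually_modeRun_time_le {S : Type} [Fintype S] [Nonempty S] {M : ∀ i, MRF (n i) S}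
    (hρ : ∀ i, 1 ≤ ρ i) (h0 : ∀ i, 0 < ε i) (h1 : ∀ i, ε i < 1)
    (hdim : ∀ i, doublingDim (M i).graph ≤ ρ i) (hn : Tendsto n l atTop)
    (ho : (fun i => ρ i * (ρ i + Real.log (1 / ε i))) =o[l] fun i => Real.log (Real.log (n i)))
    {δ c : ℝ} (hδ : 0 < δ) (hc : 0 < c) :
    ∀ᶠ i in l, ∀ r ∈ ((M i).modeRun (rate (ε i) (ρ i)) (rate_mem (h0 i) (h1 i) (hρ i))
        ⌈radius (rate (ε i) (ρ i)) (ρ i)⌉₊).support,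
      (r.time : ℝ) ≤ c * (n i : ℝ) ^ (1 + δ) := by
  filter_upwards [hn.eventually_gt_atTop 0, eventually_two_rpow_mul_rpow_le
    (s := (max (Fintype.card S) 2 : ℕ)) hρ h0 (fun i => (h1 i).le) hn ho
    (Nat.cast_le.2 (le_max_right _ _)) hδ (show 0 < c / 82 by positivity)] with i hni hi r hr
  have htime := modeRun_time_le_rpow (hρ i) (h0 i) (h1 i) hni (hdim i) (le_max_left _ 2)
    (le_max_right _ _) hr
  calc (r.time : ℝ) ≤ 82 * n i * ((2 : ℝ) ^ ρ i * ((max (Fintype.card S) 2 : ℕ) : ℝ) ^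
        (radius (rate (ε i) (ρ i)) (ρ i) ^ (2 * ρ i))) := htime.trans_eq (by ring)
    _ ≤ 82 * n i * (c / 82 * (n i : ℝ) ^ δ) := by gcongr
    _ = c * (n i : ℝ) ^ (1 + δ) := by
        rw [Real.rpow_one_add' (Nat.cast_nonneg _) (by linarith)]
        ring

end Asymptotics

end ModeAlg

open ModeAlg in
theorem mainTheorem3 :
    (∃ C : ℝ, ∀ (n : ℕ) (S : Type) [Fintype S] [Nonempty S] (M : MRF n S) (ρ ε : ℝ)
        (hρ : 1 ≤ ρ) (h0 : 0 < ε) (h1 : ε < 1),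
        0 < n → doublingDim M.graph ≤ ρ →
        (∀ μ : PMF (Finset M.Edge × (Fin n → S)),
          M.IsModeLaw (rate ε ρ) (rate_mem h0 h1 hρ) ⌈radius (rate ε ρ) ρ⌉₊ μ →
          ∀ xs : Fin n → S, M.IsMAP xs →
            ∑ z, (μ z).toReal * (M.energy xs - M.energy z.2) ≤ ε * M.energy xs) ∧
        M.IsModeLaw (rate ε ρ) (rate_mem h0 h1 hρ) ⌈radius (rate ε ρ) ρ⌉₊
          ((M.modeRun (rate ε ρ) (rate_mem h0 h1 hρ) ⌈radius (rate ε ρ) ρ⌉₊).map Timed.val) ∧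
        (2 ≤ Fintype.card S →
          ∀ r ∈ (M.modeRun (rate ε ρ) (rate_mem h0 h1 hρ) ⌈radius (rate ε ρ) ρ⌉₊).support,
            (r.time : ℝ) ≤
              C * (n * (2 : ℝ) ^ ρ * (Fintype.card S : ℝ) ^ (radius (rate ε ρ) ρ ^ (2 * ρ))))) ∧
    (∀ (S : Type) [Fintype S] [Nonempty S] (n : ℕ → ℕ) (M : ∀ i, MRF (n i) S) (ρ ε : ℕ → ℝ)
        (hρ : ∀ i, 1 ≤ ρ i) (h0 : ∀ i, 0 < ε i) (h1 : ∀ i, ε i < 1),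
        (∀ i, doublingDim (M i).graph ≤ ρ i) →
        Tendsto n atTop atTop →
        (fun i => ρ i * (ρ i + Real.log (1 / ε i))) =o[atTop]
          (fun i => Real.log (Real.log (n i))) →
        ∀ δ : ℝ, 0 < δ → ∀ c : ℝ, 0 < c → ∀ᶠ i in atTop,
          ∀ r ∈ ((M i).modeRun (rate (ε i) (ρ i)) (rate_mem (h0 i) (h1 i) (hρ i))
              ⌈radius (rate (ε i) (ρ i)) (ρ i)⌉₊).support,
            (r.time : ℝ) ≤ c * (n i : ℝ) ^ (1 + δ)) := by
  refine ⟨⟨82, fun n S _ _ M ρ ε hρ h0 h1 hn hdim => ⟨fun μ hμ xs _ => ?_, ?_, ?_⟩⟩, ?_⟩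
  · exact MRF.expected_loss_le_of_doublingDim_le hρ h0 h1 hn hdim hμ xs
  · exact M.isModeLaw_modeRun _ _ _
  · exact fun hS r hr => MRF.modeRun_time_le_rpow hρ h0 h1 hn hdim le_rfl hS hr
  · intro S _ _ n M ρ ε hρ h0 h1 hdim hn ho δ hδ c hc
    exact MRF.eventually_modeRun_time_le hρ h0 h1 hdim hn ho hδ hc
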